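/- **Notation.** Let $\log$ be the principal branch of the logarithm ($-\pi<\arg\le\pi$, with the convention $0\cdot\log 0=0$), $P_k$ the Legendre polynomials, $\Omega=[-1,1]^2$, and let $C_k^{(\lambda)}$ be the ultraspherical polynomials, given for every $\lambda$ by $C_0^{(\lambda)}(x)=1$, $C_1^{(\lambda)}(x)=2\lambda x$ and $(k+2)C_{k+2}^{(\lambda)}(x)=2(k+1+\lambda)xC_{k+1}^{(\lambda)}(x)-(k+2\lambda)C_k^{(\lambda)}(x)$. For $z=x+\mathrm i y\in\mathbb C$ and $k,j\ge 0$ put $$L_{kj}(z)=\iint_\Omega \log\bigl(z-(s+\mathrm i t)\bigr)P_k(s)P_j(t)\,ds\,dt,\qquad S_{kj}(z)=\iint_\Omega\frac{P_k(s)P_j(t)}{z-(s+\mathrm i t)}\,ds\,dt,$$ $$L_k(z)=\int_{-1}^1\log(z-t)P_k(t)\,dt,\qquad M_k(z)=\int_{-1}^1\log(z-\mathrm i t)P_k(t)\,dt,\qquad L_{-1}=M_{-1}=0 .$$ Let $L(z)=(L_{kj}(z))_{k,j\ge0}$ and $S(z)=(S_{kj}(z))_{k,j\ge0}$ be the infinite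 matrices with row index $k$ and column index $j$; let $\mathbf e_0,\mathbf e_1,\dots$ be the unit vectors and $\mathbf e_{-1}=0$. Let $A$ and $B$ be the infinite tridiagonal matrices with zero diagonal and $$A_{k,k-1}=\tfrac{k-1}{2k+1},\quad A_{k,k+1}=\tfrac{k+2}{2k+1},\quad B_{k,k-1}=\tfrac{k}{2k+1},\quad B_{k,k+1}=\tfrac{k+1}{2k+1},$$ and let $C=A-B$, so that $C_{k,k+1}=\frac1{2k+1}=-C_{k,k-1}$. Let $\log_-w=\log|w|-\mathrm i\pi$ for $w\in(-\infty,0)$ and $\log_-w=\log w$ otherwise. Define $$\lambda_k(z)=\begin{cases}(z-1)\log(z-1)+(z+1)\log(z+1)&k=0\\-2/3&k=1\\0&k\ge2,\end{cases}$$ $$\mu_k(z)=\begin{cases}(z-\mathrm i)\log(z-\mathrm i)+(z+\mathrm i)\log_-(z+\mathrm i)&k=0\\-2\mathrm i/3&k=1\\0&k\ge2\end{cases}\;-\;\begin{cases}2\mathrm i\pi x\,C_{k+1}^{(-1/2)}(y)&x<0,\ -1<y<1\\0&\text{otherwise,}\end{cases}$$ $$\beta_{kj}(z)=2\mathrm i\pi\,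 C_{j+1}^{(-1/2)}(y)\begin{cases}\frac13C_{k+2}^{(-3/2)}(x)-\delta_{k0}x+\frac13\delta_{k1}&-1\le x\le1,\ -1\le y<1\\-2x\,\delta_{k0}+\frac23\delta_{k1}&x<-1,\ -1\le y<1\\0&\text{otherwise.}\end{cases}$$ Let $F^{(1)}(z)$ and $F^{(2)}(z)$ be the infinite matrices with $$F^{(1)}_{0j}(z)=\mathrm i\,\frac{M_{j+1}(z-1)+M_{j+1}(z+1)-M_{j-1}(z-1)-M_{j-1}(z+1)}{2j+1}+\mu_j(z-1)+\mu_j(z+1),$$ $F^{(1)}_{10}(z)=-\frac43$ and all other entries of $F^{(1)}(z)$ zero; $$F^{(2)}_{k0}(z)=\frac{L_{k+1}(z-\mathrm i)+L_{k+1}(z+\mathrm i)-L_{k-1}(z-\mathrm i)-L_{k-1}(z+\mathrm i)}{2k+1}+\lambda_k(z-\mathrm i)+\lambda_k(z+\mathrm i)+\beta_{k0}(z),$$ $F^{(2)}_{01}(z)=-\frac{4\mathrm i}3+\beta_{01}(z)$ and $F^{(2)}_{kj}(z)=\beta_{kj}(z)$ for all other $(k,j)$ with $j\ne0$. Let $F(z)=F^{(2)}(z)-F^{(1)}(z)$.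 **Statement.** Let $z\in\mathbb C$. 1. For all $j\ge0$ and all $k\ge0$, $$\mathrm i L(z)\mathbf e_{j-1}+(2j+1)\,C L(z)\mathbf e_j-\mathrm i L(z)\mathbf e_{j+1}=(2j+1)F(z)\mathbf e_j,$$ $$-L(z)^\top\mathbf e_{k-1}-\mathrm i(2k+1)\,CL(z)^\top\mathbf e_k+L(z)^\top\mathbf e_{k+1}=(2k+1)F(z)^\top\mathbf e_k .$$ 2. For all $j\ge1$ and all $k\ge1$, $$\mathrm i j\,S(z)\mathbf e_{j-1}+(2j+1)(B-zI)S(z)\mathbf e_j+\mathrm i(j+1)S(z)\mathbf e_{j+1}=0,$$ $$k\,S(z)^\top\mathbf e_{k-1}+(2k+1)(\mathrm i B-zI)S(z)^\top\mathbf e_k+(k+1)S(z)^\top\mathbf e_{k+1}=0 .$$ 3. These recurrences determine all entries from the first row and column: if an infinite matrix $X$ satisfies the recurrences in 1 (with the same $F(z)$) and has the same first row and first column as $L(z)$, then $X=L(z)$; if it satisfies the recurrences in 2 and has the same first row and first column as $S(z)$, then $X=S(z)$. 4. They compute all entries by forward substitution: for every $p\ge0$, start from the entries of total degree $k+j\le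 p$ in the first row and the first column of $L(z)$ (and the entries of $F(z)$ with $k+j\le p$), and for $\ell=0,\dots,\lfloor p/2\rfloor-1$ compute first the entries $(k,\ell+1)$, $\ell+1\le k\le p-\ell-1$, from columns $\ell$ and $\ell-1$ by solving the first (column) recurrence of index $j=\ell$ for them, and then the entries $(\ell+1,j)$, $\ell+2\le j\le p-\ell-1$, from rows $\ell$ and $\ell-1$ by solving the second (row) recurrence of index $k=\ell$ for them. This yields exactly all $L_{kj}(z)$ with $k+j\le p$. The same procedure with the recurrences of $S(z)$ (for $\ell=0$, the formulas in 2 are used with $j=0$ and $k=0$ in just these entries) yields exactly all $S_{kj}(z)$ with $k+j\le p$. -/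

import Mathlib

open MeasureTheory

noncomputable section

namespace SquareIntegrals

/-! ### Orthogonal polynomials -/

/-- Legendre polynomials `P_k`, by the recurrence
`(k + 2) P_{k+2}(x) = (2k + 3) x P_{k+1}(x) - (k + 1) P_k(x)`. -/
def legendreP : ℕ → ℝ → ℝ
  | 0, _ => 1
  | 1, x => x
  | k + 2, x =>
    ((2 * (k : ℝ) + 3) * x * legendreP (k + 1) x - ((k : ℝ) + 1) * legendreP k x) / ((k : ℝ) + 2)

/-- Ultraspherical polynomials `C_k^{(lam)}`, by the recurrence
`(k + 2) C_{k+2}(x) = 2 (k + 1 + lam) x C_{k+1}(x) - (k + 2 lam) C_k(x)`;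
this also makes sense for `lam = -1/2` and `lam = -3/2`. -/
def ultraC (lam : ℝ) : ℕ → ℝ → ℝ
  | 0, _ => 1
  | 1, x => 2 * lam * x
  | k + 2, x =>
    (2 * ((k : ℝ) + 1 + lam) * x * ultraC lam (k + 1) x - ((k : ℝ) + 2 * lam) * ultraC lam k x)
      / ((k : ℝ) + 2)

/-! ### The integrals -/

/-- `Ω = [-1, 1] × [-1, 1]`. -/
def square : Set (ℝ × ℝ) := Set.Icc (-1) 1 ×ˢ Set.Icc (-1) 1

/-- `L_{kj}(z) = ∬_Ω log (z - (s + i t)) P_k(s) P_j(t) ds dt`; row index `k`, column index `j`. -/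
def logMatrix (z : ℂ) : Matrix ℕ ℕ ℂ := Matrix.of fun k j =>
  ∫ p in square, Complex.log (z - ((p.1 : ℂ) + Complex.I * (p.2 : ℂ))) *
    ((legendreP k p.1 * legendreP j p.2 : ℝ) : ℂ)

/-- `S_{kj}(z) = ∬_Ω P_k(s) P_j(t) / (z - (s + i t)) ds dt`. -/
def stieltjesMatrix (z : ℂ) : Matrix ℕ ℕ ℂ := Matrix.of fun k j =>
  ∫ p in square, ((legendreP k p.1 * legendreP j p.2 : ℝ) : ℂ) /
    (z - ((p.1 : ℂ) + Complex.I * (p.2 : ℂ)))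

/-- `L_k(z) = ∫_{-1}^1 log (z - t) P_k(t) dt`. -/
def logInt (k : ℕ) (z : ℂ) : ℂ :=
  ∫ t in (-1 : ℝ)..1, Complex.log (z - (t : ℂ)) * ((legendreP k t : ℝ) : ℂ)

/-- `M_k(z) = ∫_{-1}^1 log (z - i t) P_k(t) dt`. -/
def logIntI (k : ℕ) (z : ℂ) : ℂ :=
  ∫ t in (-1 : ℝ)..1, Complex.log (z - Complex.I * (t : ℂ)) * ((legendreP k t : ℝ) : ℂ)

/-! ### The inhomogeneity `F = F⁽²⁾ - F⁽¹⁾` -/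

/-- The term of index `k - 1` of a sequence, with the term of index `-1` taken to be `0`. -/
def prevTerm (f : ℕ → ℂ) : ℕ → ℂ
  | 0 => 0
  | k + 1 => f k

/-- The logarithm that takes the limit from below along its branch cut. -/
def logMinus (z : ℂ) : ℂ :=
  if z.im = 0 ∧ z.re < 0 then (Real.log ‖z‖ : ℂ) - Complex.I * (Real.pi : ℂ) else Complex.log z

/-- `λ_k(z)`. -/
def lambdaTerm (k : ℕ) (z : ℂ) : ℂ :=
  if k = 0 then (z - 1) * Complex.log (z - 1) + (z + 1) * Complex.log (z + 1)
  else if k = 1 then -2 / 3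
  else 0

/-- `μ_k(z)`. -/
def muTerm (k : ℕ) (z : ℂ) : ℂ :=
  (if k = 0 then
      (z - Complex.I) * Complex.log (z - Complex.I) + (z + Complex.I) * logMinus (z + Complex.I)
    else if k = 1 then -2 * Complex.I / 3
    else 0)
  - (if z.re < 0 ∧ -1 < z.im ∧ z.im < 1 then
      2 * Complex.I * (Real.pi : ℂ) * (z.re : ℂ) * ((ultraC (-1 / 2) (k + 1) z.im : ℝ) : ℂ)
    else 0)

/-- `β_{kj}(z)`, with `z = x + i y`. Both nonzero cases are taken for `-1 ≤ y < 1` (lower edge in,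
upper edge out), which is what the principal branch of the logarithm requires. -/
def betaTerm (k j : ℕ) (z : ℂ) : ℂ :=
  2 * Complex.I * (Real.pi : ℂ) * ((ultraC (-1 / 2) (j + 1) z.im : ℝ) : ℂ) *
    (if -1 ≤ z.re ∧ z.re ≤ 1 ∧ -1 ≤ z.im ∧ z.im < 1 then
      ((ultraC (-3 / 2) (k + 2) z.re / 3 - (if k = 0 then z.re else 0)
        + (if k = 1 then 1 / 3 else 0) : ℝ) : ℂ)
    else if z.re < -1 ∧ -1 ≤ z.im ∧ z.im < 1 then
      (((if k = 0 then -2 * z.re else 0) + (if k = 1 then 2 / 3 else 0) : ℝ) : ℂ)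
    else 0)

/-- `F⁽¹⁾_{kj}(z)`. -/
def F1 (z : ℂ) : Matrix ℕ ℕ ℂ := Matrix.of fun k j =>
  if k = 0 then
    Complex.I * (logIntI (j + 1) (z - 1) + logIntI (j + 1) (z + 1)
        - prevTerm (fun m => logIntI m (z - 1)) j - prevTerm (fun m => logIntI m (z + 1)) j)
      / (2 * (j : ℂ) + 1)
    + muTerm j (z - 1) + muTerm j (z + 1)
  else if k = 1 ∧ j = 0 then -4 / 3
  else 0

/-- `F⁽²⁾_{kj}(z)`. -/
def F2 (z : ℂ) : Matrix ℕ ℕ ℂ := Matrix.of fun k j =>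
  if j = 0 then
    (logInt (k + 1) (z - Complex.I) + logInt (k + 1) (z + Complex.I)
        - prevTerm (fun m => logInt m (z - Complex.I)) k
        - prevTerm (fun m => logInt m (z + Complex.I)) k)
      / (2 * (k : ℂ) + 1)
    + lambdaTerm k (z - Complex.I) + lambdaTerm k (z + Complex.I) + betaTerm k 0 z
  else if k = 0 ∧ j = 1 then -4 * Complex.I / 3 + betaTerm 0 1 z
  else betaTerm k j z

/-- `F(z) = F⁽²⁾(z) - F⁽¹⁾(z)`. -/
def FMatrix (z : ℂ) : Matrix ℕ ℕ ℂ := F2 z - F1 z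

/-! ### Infinite matrices and vectors -/

/-- `A v` for an infinite matrix `A` and a vector `v`; it is used only where, in each row, all but
finitely many of the products `A k m * v m` vanish. -/
def mulV (A : Matrix ℕ ℕ ℂ) (v : ℕ → ℂ) : ℕ → ℂ := fun k => ∑ᶠ m, A k m * v m

/-- The unit vector `e_n`, `n ≥ 0`; `e_{-1} = 0`. -/
def e (n : ℤ) : ℕ → ℂ := fun m => if (m : ℤ) = n then 1 else 0

/-- The tridiagonal matrix with `A_{k,k-1} = (k-1)/(2k+1)`, `A_{k,k+1} = (k+2)/(2k+1)`. -/
def matA : Matrix ℕ ℕ ℂ := Matrix.of fun k m =>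
  if m = k + 1 then ((k : ℂ) + 2) / (2 * (k : ℂ) + 1)
  else if m + 1 = k then ((k : ℂ) - 1) / (2 * (k : ℂ) + 1)
  else 0

/-- The tridiagonal matrix with `B_{k,k-1} = k/(2k+1)`, `B_{k,k+1} = (k+1)/(2k+1)`. -/
def matB : Matrix ℕ ℕ ℂ := Matrix.of fun k m =>
  if m = k + 1 then ((k : ℂ) + 1) / (2 * (k : ℂ) + 1)
  else if m + 1 = k then (k : ℂ) / (2 * (k : ℂ) + 1)
  else 0

/-- `C = A - B`. -/
def matC : Matrix ℕ ℕ ℂ := matA - matB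

/-! ### The recurrences -/

/-- `i X e_{j-1} + (2j+1) C X e_j - i X e_{j+1} = (2j+1) F e_j`. -/
def LogColumnRec (F X : Matrix ℕ ℕ ℂ) (j : ℕ) : Prop :=
  Complex.I • mulV X (e (j - 1)) + (2 * (j : ℂ) + 1) • mulV matC (mulV X (e j))
    - Complex.I • mulV X (e (j + 1)) = (2 * (j : ℂ) + 1) • mulV F (e j)

/-- `-Xᵀ e_{k-1} - i (2k+1) C Xᵀ e_k + Xᵀ e_{k+1} = (2k+1) Fᵀ e_k`. -/
def LogRowRec (F X : Matrix ℕ ℕ ℂ) (k : ℕ) : Prop :=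
  -mulV X.transpose (e (k - 1))
    - (Complex.I * (2 * (k : ℂ) + 1)) • mulV matC (mulV X.transpose (e k))
    + mulV X.transpose (e (k + 1)) = (2 * (k : ℂ) + 1) • mulV F.transpose (e k)

/-- `i j X e_{j-1} + (2j+1) (B - z I) X e_j + i (j+1) X e_{j+1} = 0`. -/
def StieltjesColumnRec (z : ℂ) (X : Matrix ℕ ℕ ℂ) (j : ℕ) : Prop :=
  (Complex.I * (j : ℂ)) • mulV X (e (j - 1))
    + (2 * (j : ℂ) + 1) • mulV (matB - z • (1 : Matrix ℕ ℕ ℂ)) (mulV X (e j))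
    + (Complex.I * ((j : ℂ) + 1)) • mulV X (e (j + 1)) = 0

/-- `k Xᵀ e_{k-1} + (2k+1) (i B - z I) Xᵀ e_k + (k+1) Xᵀ e_{k+1} = 0`. -/
def StieltjesRowRec (z : ℂ) (X : Matrix ℕ ℕ ℂ) (k : ℕ) : Prop :=
  (k : ℂ) • mulV X.transpose (e (k - 1))
    + (2 * (k : ℂ) + 1) •
      mulV (Complex.I • matB - z • (1 : Matrix ℕ ℕ ℂ)) (mulV X.transpose (e k))
    + ((k : ℂ) + 1) • mulV X.transpose (e (k + 1)) = 0

/-! ### Computing all entries up to total degree `p` by forward substitution -/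

/-- The column of index `j + 1`, from the columns of index `j` and `j - 1`. -/
def logNextColumn (F X : Matrix ℕ ℕ ℂ) (j : ℕ) : ℕ → ℂ :=
  mulV X (e (j - 1))
    - (Complex.I * (2 * (j : ℂ) + 1)) • (mulV matC (mulV X (e j)) - mulV F (e j))

/-- The row of index `k + 1`, from the rows of index `k` and `k - 1`. -/
def logNextRow (F X : Matrix ℕ ℕ ℂ) (k : ℕ) : ℕ → ℂ :=
  mulV X.transpose (e (k - 1))
    + (2 * (k : ℂ) + 1) •
      (Complex.I • mulV matC (mulV X.transpose (e k)) + mulV F.transpose (e k))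

/-- The column of index `j + 1`, from the columns of index `j` and `j - 1`. -/
def stieltjesNextColumn (z : ℂ) (X : Matrix ℕ ℕ ℂ) (j : ℕ) : ℕ → ℂ :=
  (Complex.I / ((j : ℂ) + 1)) •
    ((Complex.I * (j : ℂ)) • mulV X (e (j - 1))
      + (2 * (j : ℂ) + 1) • mulV (matB - z • (1 : Matrix ℕ ℕ ℂ)) (mulV X (e j)))

/-- The row of index `k + 1`, from the rows of index `k` and `k - 1`. -/
def stieltjesNextRow (z : ℂ) (X : Matrix ℕ ℕ ℂ) (k : ℕ) : ℕ → ℂ :=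
  (-1 / ((k : ℂ) + 1)) •
    ((k : ℂ) • mulV X.transpose (e (k - 1))
      + (2 * (k : ℂ) + 1) •
        mulV (Complex.I • matB - z • (1 : Matrix ℕ ℕ ℂ)) (mulV X.transpose (e k)))

/-- Step `l`, first half: fill in the entries `(k, l+1)` with `l+1 ≤ k ≤ p-l-1`. -/
def fillColumn (nextColumn : Matrix ℕ ℕ ℂ → ℕ → ℕ → ℂ) (p l : ℕ) (X : Matrix ℕ ℕ ℂ) :
    Matrix ℕ ℕ ℂ := Matrix.of fun k j =>
  if j = l + 1 ∧ l + 1 ≤ k ∧ k + l + 1 ≤ p then nextColumn X l k else X k j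

/-- Step `l`, second half: fill in the entries `(l+1, j)` with `l+2 ≤ j ≤ p-l-1`. -/
def fillRow (nextRow : Matrix ℕ ℕ ℂ → ℕ → ℕ → ℂ) (p l : ℕ) (X : Matrix ℕ ℕ ℂ) :
    Matrix ℕ ℕ ℂ := Matrix.of fun k j =>
  if k = l + 1 ∧ l + 2 ≤ j ∧ j + l + 1 ≤ p then nextRow X l j else X k j

/-- Steps `0, …, n - 1`, each filling in part of a column and then part of a row. -/
def fillSteps (nextColumn nextRow : Matrix ℕ ℕ ℂ → ℕ → ℕ → ℂ) (p : ℕ) (X : Matrix ℕ ℕ ℂ) :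
    ℕ → Matrix ℕ ℕ ℂ
  | 0 => X
  | l + 1 => fillRow nextRow p l (fillColumn nextColumn p l (fillSteps nextColumn nextRow p X l))

/-- `X^p`: the entries of `X` of total degree at most `p` (zeros elsewhere). -/
def truncDegree (p : ℕ) (X : Matrix ℕ ℕ ℂ) : Matrix ℕ ℕ ℂ := Matrix.of fun k j =>
  if k + j ≤ p then X k j else 0

/-- The first row and column of `X^p` (zeros elsewhere). -/
def firstRowColumn (p : ℕ) (X : Matrix ℕ ℕ ℂ) : Matrix ℕ ℕ ℂ := Matrix.of fun k j =>
  if (k = 0 ∨ j = 0) ∧ k + j ≤ p then X k j else 0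

/-- The routine for `L^p(z)`; its input is `F^p(z)` and the first row and column of `L^p(z)`. -/
def logAlgorithm (p : ℕ) (F X : Matrix ℕ ℕ ℂ) : Matrix ℕ ℕ ℂ :=
  fillSteps (logNextColumn F) (logNextRow F) p X (p / 2)

/-- The routine for `S^p(z)`; its input is `z` and the first row and column of `S^p(z)`. -/
def stieltjesAlgorithm (p : ℕ) (z : ℂ) (X : Matrix ℕ ℕ ℂ) : Matrix ℕ ℕ ℂ :=
  fillSteps (stieltjesNextColumn z) (stieltjesNextRow z) p X (p / 2)

end SquareIntegrals

end

noncomputable section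

namespace SquareIntegrals

/-! ### Identities for the orthogonal polynomials -/

/-! Read at the entry `(k, j)`, the column and the row recurrence are one and the same scalar
identity, `LogEntryRec` for `L` and `StieltjesEntryRec` for `S`; everything reduces to these two.

For `L`, put `Q_k = (P_{k+1} - P_{k-1})/(2k+1)`, an antiderivative of `P_k`. The identity compares
`∬ log(z-s-it) Q_k(s) P_j(t)` with `i` times `∬ log(z-s-it) P_k(s) Q_j(t)`. Integration by parts in
`t` for the first and in `s` for the second leaves the same area term `i ∬ Q_k Q_j/(z-s-it)`, which
cancels. What remains is `F`. Since `Q_k(±1) = 0` for `k ≥ 1`, edge integrals occur only in the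
first row and column. Horizontal lines other than `t = y` miss the branch cut. A vertical line to
the right of `x` crosses it when `-1 ≤ y < 1`, and contributes the jump `2πi Q_j(y)`; integrated
against `Q_k` over `s > x`, this gives the cut term (`integral_log_mul_legendreQ_mul_legendreP`,
`integral_log_mul_legendreP_mul_legendreQ`, `FMatrix_apply`).

For `S`, the three-term recurrence of `P_k` turns the identity into the integral of `(s + it -
z)/(z-s-it) = -1` against `P_k(s) P_j(t)`, which vanishes by orthogonality to constants unless `k =
j = 0`.

Uniqueness and forward substitution follow by solving the scalar identity for `X k (j+1)` or `X
(k+1) j`; both have the same total degree, so no entry beyond degree `p` is needed. -/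

theorem ultraC_add_two (lam : ℝ) (k : ℕ) (x : ℝ) :
    ((k : ℝ) + 2) * ultraC lam (k + 2) x
      = 2 * ((k : ℝ) + 1 + lam) * x * ultraC lam (k + 1) x
        - ((k : ℝ) + 2 * lam) * ultraC lam k x := by
  have : (k : ℝ) + 2 ≠ 0 := by positivity
  rw [ultraC]
  field_simp

theorem legendreP_add_two (k : ℕ) (x : ℝ) :
    ((k : ℝ) + 2) * legendreP (k + 2) x
      = (2 * (k : ℝ) + 3) * x * legendreP (k + 1) x - ((k : ℝ) + 1) * legendreP k x := by
  have : (k : ℝ) + 2 ≠ 0 := by positivity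
  rw [legendreP]
  field_simp

theorem ultraC_half_eq_legendreP (k : ℕ) (x : ℝ) : ultraC (1 / 2) k x = legendreP k x := by
  induction k using Nat.twoStepInduction with
  | zero => rfl
  | one => simp [ultraC, legendreP]
  | more n h1 h2 =>
    rw [ultraC, legendreP, h1, h2]
    ring

theorem continuous_ultraC (lam : ℝ) (k : ℕ) : Continuous (ultraC lam k) := by
  induction k using Nat.twoStepInduction with
  | zero => exact continuous_const
  | one => exact continuous_const.mul continuous_id
  | more n h1 h2 =>
    have h : ultraC lam (n + 2) = fun x => (2 * ((n : ℝ) + 1 + lam) * x * ultraC lam (n + 1) x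
        - ((n : ℝ) + 2 * lam) * ultraC lam n x) / ((n : ℝ) + 2) := by
      funext x; rw [ultraC]
    rw [h]
    fun_prop

theorem continuous_legendreP (k : ℕ) : Continuous (legendreP k) := by
  have : legendreP k = ultraC (1 / 2) k := funext fun x => (ultraC_half_eq_legendreP k x).symm
  rw [this]
  exact continuous_ultraC _ _

/-- The contiguous relation `(n + 2 + lam) C_{n+2}^{(lam)} = lam (C_{n+2}^{(lam+1)} - C_n^{(lam+1)})`. -/
theorem ultraC_contiguous (lam : ℝ) (hlam : ∀ n : ℕ, (n : ℝ) + 1 + lam ≠ 0) (n : ℕ) (x : ℝ) :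
    ((n : ℝ) + 2 + lam) * ultraC lam (n + 2) x
      = lam * (ultraC (lam + 1) (n + 2) x - ultraC (lam + 1) n x) := by
  induction n using Nat.twoStepInduction with
  | zero => simp only [ultraC]; push_cast; ring
  | one =>
    simp only [ultraC]
    push_cast
    ring
  | more n h1 h2 =>
    have e1 := ultraC_add_two lam (n + 2) x
    have f1 := ultraC_add_two (lam + 1) (n + 2) x
    have f3 := ultraC_add_two (lam + 1) n x
    push_cast at *
    have g1 : (n : ℝ) + 2 + lam ≠ 0 := by
      have := hlam (n + 1); push_cast at this; convert this using 1; ring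
    have g2 : (n : ℝ) + 3 + lam ≠ 0 := by
      have := hlam (n + 2); push_cast at this; convert this using 1; ring
    have g3 : (n : ℝ) + 4 ≠ 0 := by positivity
    -- The factor `n + 4` admits the recurrence for degree `n + 4`, and `n + 2 + lam` lets `h1`
    -- replace the term of degree `n + 2`.
    apply mul_left_cancel₀ (mul_ne_zero g1 g3)
    generalize ultraC lam (n + 2 + 2) x = c4 at *
    generalize ultraC (lam + 1) (n + 2 + 2) x = d4 at *
    have a3 : n + 2 + 1 = n + 1 + 2 := rfl
    rw [a3] at *
    generalize ultraC lam (n + 1 + 2) x = c3 at *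
    generalize ultraC (lam + 1) (n + 1 + 2) x = d3 at *
    have a2 : n + 1 + 1 = n + 2 := rfl
    rw [a2] at *
    generalize ultraC lam (n + 2) x = c2 at *
    generalize ultraC (lam + 1) (n + 2) x = d2 at *
    generalize ultraC (lam + 1) (n + 1) x = d1 at *
    generalize ultraC (lam + 1) n x = d0 at *
    generalize (n : ℝ) = m at *
    linear_combination (m + 2 + lam) * (m + 4 + lam) * e1
      + (m + 2 + lam) * (m + 4 + lam) * 2 * x * h2
      - (m + 4 + lam) * (m + 2 + 2 * lam) * h1 - lam * (m + 2 + lam) * f1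
      + lam * (m + 4 + lam) * f3

/-- Differentiating the three-term recurrence and replacing the undifferentiated term by
`ultraC_contiguous` yields the recurrence for `lam + 1`. Applied at `-1/2` and `-3/2`, it gives the
first and second antiderivatives of `P_k`. -/
theorem hasDerivAt_ultraC (lam : ℝ) (hlam : ∀ n : ℕ, (n : ℝ) + 1 + lam ≠ 0) (n : ℕ) (x : ℝ) :
    HasDerivAt (ultraC lam (n + 1)) (2 * lam * ultraC (lam + 1) n x) x := by
  induction n using Nat.twoStepInduction with
  | zero =>
    have h : ultraC lam (0 + 1) = fun x => 2 * lam * x := rfl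
    rw [h]
    simpa [ultraC] using (hasDerivAt_id x).const_mul (2 * lam)
  | one =>
    have h : ultraC lam (1 + 1) = fun x => lam * (1 + lam) * 2 * x ^ 2 - lam := by
      funext x; simp only [ultraC]; push_cast; ring
    rw [h]
    refine HasDerivAt.congr_deriv
      (((hasDerivAt_pow 2 x).const_mul (lam * (1 + lam) * 2)).sub_const lam) ?_
    simp only [ultraC]; push_cast; ring
  | more n h1 h2 =>
    have h : ultraC lam (n + 2 + 1) = fun x =>
        (2 * (((n + 1 : ℕ) : ℝ) + 1 + lam) * (x * ultraC lam (n + 1 + 1) x)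
          - (((n + 1 : ℕ) : ℝ) + 2 * lam) * ultraC lam (n + 1) x)
          * (((n + 1 : ℕ) : ℝ) + 2)⁻¹ := by
      funext x; rw [show n + 2 + 1 = n + 1 + 2 from rfl, ultraC]; ring
    rw [h]
    refine HasDerivAt.congr_deriv (((((hasDerivAt_id x).mul h2).const_mul
      (2 * (((n + 1 : ℕ) : ℝ) + 1 + lam))).sub
      (h1.const_mul (((n + 1 : ℕ) : ℝ) + 2 * lam))).mul_const ((((n + 1 : ℕ) : ℝ) + 2)⁻¹)) ?_
    have a1 := ultraC_contiguous lam hlam n x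
    have a2 := ultraC_add_two (lam + 1) n x
    have hn : (n : ℝ) + 1 + 2 ≠ 0 := by positivity
    simp only [id, show n + 1 + 1 = n + 2 from rfl]
    push_cast
    rw [mul_inv_eq_iff_eq_mul₀ hn]
    linear_combination 2 * a1 - 2 * lam * a2

/-- The antiderivative `(P_{k+1} - P_{k-1}) / (2k + 1)` of `P_k`, with `P_{-1} = 0`. -/
def legendreQ (k : ℕ) (x : ℝ) : ℝ := -ultraC (-1 / 2) (k + 1) x

/-- An antiderivative of `legendreQ k`. -/
def legendreR (k : ℕ) (x : ℝ) : ℝ := ultraC (-3 / 2) (k + 2) x / 3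

theorem continuous_legendreQ (k : ℕ) : Continuous (legendreQ k) := (continuous_ultraC _ _).neg

theorem nat_add_one_add_neg_half_ne_zero (n : ℕ) : (n : ℝ) + 1 + (-1 / 2) ≠ 0 := by
  have : (0 : ℝ) ≤ n := n.cast_nonneg
  linarith

theorem nat_add_one_add_neg_three_halves_ne_zero (n : ℕ) : (n : ℝ) + 1 + (-3 / 2) ≠ 0 := by
  intro h
  have h2 : (2 : ℝ) * n = 1 := by linarith
  have h3 : 2 * n = 1 := by exact_mod_cast h2
  omega

theorem hasDerivAt_legendreQ (k : ℕ) (x : ℝ) : HasDerivAt (legendreQ k) (legendreP k x) x := by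
  have h := (hasDerivAt_ultraC (-1 / 2) nat_add_one_add_neg_half_ne_zero k x).neg
  have h2 : (-1 / 2 + 1 : ℝ) = 1 / 2 := by norm_num
  rw [h2, ultraC_half_eq_legendreP] at h
  exact h.congr_deriv (by ring)

theorem hasDerivAt_legendreR (k : ℕ) (x : ℝ) : HasDerivAt (legendreR k) (legendreQ k x) x := by
  have h := (hasDerivAt_ultraC (-3 / 2) nat_add_one_add_neg_three_halves_ne_zero
    (k + 1) x).div_const 3
  have h2 : (-3 / 2 + 1 : ℝ) = -1 / 2 := by norm_num
  rw [h2] at h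
  exact h.congr_deriv (by rw [legendreQ]; ring)

theorem legendreQ_zero (x : ℝ) : legendreQ 0 x = x := by
  simp only [legendreQ, ultraC]; ring

theorem two_mul_add_one_mul_legendreQ_succ (k : ℕ) (x : ℝ) :
    (2 * (k : ℝ) + 3) * legendreQ (k + 1) x = legendreP (k + 2) x - legendreP k x := by
  have h := ultraC_contiguous (-1 / 2) nat_add_one_add_neg_half_ne_zero k x
  have h2 : (-1 / 2 + 1 : ℝ) = 1 / 2 := by norm_num
  rw [h2, ultraC_half_eq_legendreP, ultraC_half_eq_legendreP] at h
  rw [legendreQ]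
  linear_combination (-2) * h

/-- Degrees 2 and 3 are multiples of `x² - 1`, and the recurrence propagates the zeros. This is why
boundary terms survive only for index 0. -/
theorem ultraC_neg_half_of_sq_eq_one (k : ℕ) {x : ℝ} (hx : x ^ 2 = 1) :
    ultraC (-1 / 2) (k + 2) x = 0 := by
  induction k using Nat.twoStepInduction with
  | zero => simp only [ultraC]; push_cast; linear_combination (-1 / 2) * hx
  | one => simp only [ultraC]; push_cast; linear_combination (-1 / 2) * x * hx
  | more n h1 h2 => rw [ultraC, h1, show n + 2 + 1 = n + 1 + 2 from rfl, h2]; simp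

/-- Vanishing starts only at degree 4, where `(x² - 1)²` appears; degrees 2 and 3 are the source of
the terms `δ_{k0}` and `δ_{k1}/3` in `legendreR_one`. -/
theorem ultraC_neg_three_halves_of_sq_eq_one (k : ℕ) {x : ℝ} (hx : x ^ 2 = 1) :
    ultraC (-3 / 2) (k + 4) x = 0 := by
  induction k using Nat.twoStepInduction with
  | zero => simp only [ultraC]; push_cast; linear_combination (3 / 8 * (x ^ 2 - 1)) * hx
  | one => simp only [ultraC]; push_cast; linear_combination (3 / 8 * x * (x ^ 2 - 1)) * hx
  | more n h1 h2 =>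
    rw [show n + 2 + 4 = n + 4 + 2 from rfl, ultraC, h1, show n + 4 + 1 = n + 1 + 4 from rfl, h2]
    simp

theorem legendreQ_one (k : ℕ) : legendreQ k 1 = if k = 0 then 1 else 0 := by
  cases k with
  | zero => simp [legendreQ_zero]
  | succ n => simp [legendreQ, ultraC_neg_half_of_sq_eq_one]

theorem legendreQ_neg_one (k : ℕ) : legendreQ k (-1) = if k = 0 then -1 else 0 := by
  cases k with
  | zero => simp [legendreQ_zero]
  | succ n => simp [legendreQ, ultraC_neg_half_of_sq_eq_one]

theorem legendreR_one (k : ℕ) :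
    legendreR k 1 = (if k = 0 then 1 else 0) - (if k = 1 then 1 / 3 else 0) := by
  rcases k with _ | _ | n
  · simp only [legendreR, ultraC]; norm_num
  · simp only [legendreR, ultraC]; norm_num
  · simp [legendreR, ultraC_neg_three_halves_of_sq_eq_one]

theorem legendreR_neg_one (k : ℕ) :
    legendreR k (-1) = (if k = 0 then 1 else 0) + (if k = 1 then 1 / 3 else 0) := by
  rcases k with _ | _ | n
  · simp only [legendreR, ultraC]; norm_num
  · simp only [legendreR, ultraC]; norm_num
  · simp [legendreR, ultraC_neg_three_halves_of_sq_eq_one]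

theorem integral_legendreP (k : ℕ) (hk : k ≠ 0) : ∫ t in (-1 : ℝ)..1, legendreP k t = 0 := by
  rw [intervalIntegral.integral_eq_sub_of_hasDerivAt (fun x _ => hasDerivAt_legendreQ k x)
    ((continuous_legendreP k).intervalIntegrable _ _), legendreQ_one, legendreQ_neg_one]
  simp [hk]

theorem integral_legendreQ (k : ℕ) (a b : ℝ) :
    ∫ t in a..b, legendreQ k t = legendreR k b - legendreR k a :=
  intervalIntegral.integral_eq_sub_of_hasDerivAt (fun x _ => hasDerivAt_legendreR k x)
    ((continuous_legendreQ k).intervalIntegrable _ _)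

/-! ### Recurrences, uniqueness and forward substitution -/

theorem mulV_e_nat (X : Matrix ℕ ℕ ℂ) (n k : ℕ) : mulV X (e (n : ℤ)) k = X k n := by
  have h : (fun m => X k m * e (n : ℤ) m) = fun m => if m = n then X k n else 0 := by
    funext m
    by_cases hm : m = n <;> simp [e, hm]
  rw [mulV, h, finsum_eq_single _ n (by intro m hm; simp [hm])]
  simp

theorem mulV_e_nat_add_one (X : Matrix ℕ ℕ ℂ) (n k : ℕ) :
    mulV X (e ((n : ℤ) + 1)) k = X k (n + 1) := by
  exact_mod_cast mulV_e_nat X (n + 1) k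

theorem mulV_e_nat_sub_one (X : Matrix ℕ ℕ ℂ) (n k : ℕ) :
    mulV X (e ((n : ℤ) - 1)) k = prevTerm (X k) n := by
  cases n with
  | zero =>
    have h : ∀ m, X k m * e (((0 : ℕ) : ℤ) - 1) m = 0 := by
      intro m
      have : (m : ℤ) ≠ ((0 : ℕ) : ℤ) - 1 := by omega
      simp only [e, this, if_false, mul_zero]
    simp only [mulV, h, finsum_zero, prevTerm]
  | succ n =>
    have : ((n + 1 : ℕ) : ℤ) - 1 = n := by push_cast; ring
    rw [this, mulV_e_nat]
    rfl

theorem prevTerm_congr {f g : ℕ → ℂ} {n : ℕ} (h : ∀ m, m + 1 = n → f m = g m) :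
    prevTerm f n = prevTerm g n := by
  cases n with
  | zero => rfl
  | succ n => exact h n rfl

theorem mulV_eq_of_tridiagonal (A : Matrix ℕ ℕ ℂ) (v : ℕ → ℂ) (k : ℕ)
    (hA : ∀ m, m ≠ k + 1 → m ≠ k → m + 1 ≠ k → A k m = 0) :
    mulV A v k = A k (k + 1) * v (k + 1) + A k k * v k + prevTerm (fun m => A k m * v m) k := by
  have hs : (Function.support fun m => A k m * v m) ⊆ ((Finset.range (k + 2) : Finset ℕ) : Set ℕ) := by
    intro m hm
    by_contra hc
    apply hm
    simp only [Finset.coe_range, Set.mem_Iio, not_lt] at hc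
    simp [hA m (by omega) (by omega) (by omega)]
  rw [mulV, finsum_eq_sum_of_support_subset _ hs, Finset.sum_range_succ, Finset.sum_range_succ]
  cases k with
  | zero => simp [prevTerm]; ring
  | succ n =>
    rw [Finset.sum_range_succ, Finset.sum_eq_zero]
    · simp only [prevTerm]; ring
    · intro m hm
      rw [Finset.mem_range] at hm
      rw [hA m (by omega) (by omega) (by omega), zero_mul]

theorem mulV_matC (v : ℕ → ℂ) (k : ℕ) :
    mulV matC v k = (v (k + 1) - prevTerm v k) / (2 * (k : ℂ) + 1) := by
  rw [mulV_eq_of_tridiagonal]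
  · cases k with
    | zero => simp [matC, matA, matB, prevTerm]; ring
    | succ n =>
      have h1 : ¬ n = n + 1 + 1 := by omega
      simp [matC, matA, matB, prevTerm, h1]; ring
  · intro m h1 h2 h3
    simp [matC, matA, matB, h1, h3]

theorem mulV_smul_matB_sub (c z : ℂ) (v : ℕ → ℂ) (k : ℕ) :
    mulV (c • matB - z • (1 : Matrix ℕ ℕ ℂ)) v k
      = c * (((k : ℂ) + 1) * v (k + 1) + (k : ℂ) * prevTerm v k) / (2 * (k : ℂ) + 1) - z * v k := by
  rw [mulV_eq_of_tridiagonal]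
  · cases k with
    | zero => simp [matB, prevTerm]; ring
    | succ n =>
      have h1 : ¬ n = n + 1 + 1 := by omega
      simp [matB, prevTerm, h1]; ring
  · intro m h1 h2 h3
    simp [matB, h1, h3, Ne.symm h2]

theorem mulV_matB_sub (z : ℂ) (v : ℕ → ℂ) (k : ℕ) :
    mulV (matB - z • (1 : Matrix ℕ ℕ ℂ)) v k
      = (((k : ℂ) + 1) * v (k + 1) + (k : ℂ) * prevTerm v k) / (2 * (k : ℂ) + 1) - z * v k := by
  simpa using mulV_smul_matB_sub 1 z v k

/-- The common entry `(k, j)` of the two recurrences for `L(z)`. -/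
def LogEntryRec (F X : Matrix ℕ ℕ ℂ) (k j : ℕ) : Prop :=
  (X (k + 1) j - prevTerm (fun m => X m j) k) / (2 * (k : ℂ) + 1)
    - Complex.I * ((X k (j + 1) - prevTerm (X k) j) / (2 * (j : ℂ) + 1)) = F k j

/-- The common entry `(k, j)` of the two recurrences for `S(z)`. -/
def StieltjesEntryRec (z : ℂ) (X : Matrix ℕ ℕ ℂ) (k j : ℕ) : Prop :=
  (((k : ℂ) + 1) * X (k + 1) j + (k : ℂ) * prevTerm (fun m => X m j) k) / (2 * (k : ℂ) + 1)
    + Complex.I * ((((j : ℂ) + 1) * X k (j + 1) + (j : ℂ) * prevTerm (X k) j)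
      / (2 * (j : ℂ) + 1)) - z * X k j = 0

theorem two_mul_natCast_add_one_ne_zero (n : ℕ) : (2 * (n : ℂ) + 1) ≠ 0 := by
  exact_mod_cast (by omega : 2 * n + 1 ≠ 0)

theorem natCast_add_one_ne_zero' (n : ℕ) : ((n : ℂ) + 1) ≠ 0 := by
  exact_mod_cast (by omega : n + 1 ≠ 0)

/-- Component `k` divided by `2j + 1`; in the row version, component `j` divided by `2k + 1` gives
the same identity. -/
theorem logColumnRec_iff (F X : Matrix ℕ ℕ ℂ) (j : ℕ) :
    LogColumnRec F X j ↔ ∀ k, LogEntryRec F X k j := by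
  rw [LogColumnRec, funext_iff]
  refine forall_congr' fun k => ?_
  have hj := two_mul_natCast_add_one_ne_zero j
  have hv : mulV X (e (j : ℤ)) = fun m => X m j := funext fun m => mulV_e_nat X j m
  simp only [Pi.add_apply, Pi.sub_apply, Pi.smul_apply, smul_eq_mul, mulV_e_nat_sub_one,
    mulV_e_nat_add_one, mulV_e_nat, mulV_matC, LogEntryRec, hv]
  generalize hc : (X k (j + 1) - prevTerm (X k) j) / (2 * (j : ℂ) + 1) = c
  rw [div_eq_iff hj] at hc
  constructor <;> intro h
  · apply mul_left_cancel₀ hj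
    linear_combination h + Complex.I * hc
  · linear_combination (2 * (j : ℂ) + 1) * h - Complex.I * hc

theorem logRowRec_iff (F X : Matrix ℕ ℕ ℂ) (k : ℕ) :
    LogRowRec F X k ↔ ∀ j, LogEntryRec F X k j := by
  rw [LogRowRec, funext_iff]
  refine forall_congr' fun j => ?_
  have hk := two_mul_natCast_add_one_ne_zero k
  have hv : mulV X.transpose (e (k : ℤ)) = X k := funext fun m => mulV_e_nat _ k m
  have ht : X.transpose j = fun m => X m j := rfl
  simp only [Pi.add_apply, Pi.sub_apply, Pi.neg_apply, Pi.smul_apply, smul_eq_mul,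
    mulV_e_nat_sub_one, mulV_e_nat_add_one, mulV_e_nat, mulV_matC, LogEntryRec, hv, ht,
    Matrix.transpose_apply]
  generalize hc : (X (k + 1) j - prevTerm (fun m => X m j) k) / (2 * (k : ℂ) + 1) = c
  rw [div_eq_iff hk] at hc
  constructor <;> intro h
  · apply mul_left_cancel₀ hk
    linear_combination h - hc
  · linear_combination (2 * (k : ℂ) + 1) * h + hc

theorem stieltjesColumnRec_iff (z : ℂ) (X : Matrix ℕ ℕ ℂ) (j : ℕ) :
    StieltjesColumnRec z X j ↔ ∀ k, StieltjesEntryRec z X k j := by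
  rw [StieltjesColumnRec, funext_iff]
  refine forall_congr' fun k => ?_
  have hj := two_mul_natCast_add_one_ne_zero j
  have hv : mulV X (e (j : ℤ)) = fun m => X m j := funext fun m => mulV_e_nat X j m
  simp only [Pi.add_apply, Pi.smul_apply, smul_eq_mul, mulV_e_nat_sub_one, Pi.zero_apply,
    mulV_e_nat_add_one, mulV_matB_sub, StieltjesEntryRec, hv]
  generalize hc : (((j : ℂ) + 1) * X k (j + 1) + (j : ℂ) * prevTerm (X k) j)
    / (2 * (j : ℂ) + 1) = c
  rw [div_eq_iff hj] at hc
  constructor <;> intro h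
  · apply mul_left_cancel₀ hj
    linear_combination h - Complex.I * hc
  · linear_combination (2 * (j : ℂ) + 1) * h + Complex.I * hc

theorem stieltjesRowRec_iff (z : ℂ) (X : Matrix ℕ ℕ ℂ) (k : ℕ) :
    StieltjesRowRec z X k ↔ ∀ j, StieltjesEntryRec z X k j := by
  rw [StieltjesRowRec, funext_iff]
  refine forall_congr' fun j => ?_
  have hk := two_mul_natCast_add_one_ne_zero k
  have hv : mulV X.transpose (e (k : ℤ)) = X k := funext fun m => mulV_e_nat _ k m
  have ht : X.transpose j = fun m => X m j := rfl
  simp only [Pi.add_apply, Pi.smul_apply, smul_eq_mul, mulV_e_nat_sub_one, Pi.zero_apply,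
    mulV_e_nat_add_one, mulV_smul_matB_sub, StieltjesEntryRec, hv, ht, Matrix.transpose_apply,
    mul_div_assoc Complex.I]
  generalize hc : (((k : ℂ) + 1) * X (k + 1) j + (k : ℂ) * prevTerm (fun m => X m j) k)
    / (2 * (k : ℂ) + 1) = c
  rw [div_eq_iff hk] at hc
  constructor <;> intro h
  · apply mul_left_cancel₀ hk
    linear_combination h - hc
  · linear_combination (2 * (k : ℂ) + 1) * h + hc

/-! ### Solving the scalar identities for the next column or row; uniqueness. -/

theorem LogEntryRec.eq_next_column {F X : Matrix ℕ ℕ ℂ} {k j : ℕ} (h : LogEntryRec F X k j) :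
    X k (j + 1) = prevTerm (X k) j - Complex.I * (2 * (j : ℂ) + 1) *
      ((X (k + 1) j - prevTerm (fun m => X m j) k) / (2 * (k : ℂ) + 1) - F k j) := by
  have hj := two_mul_natCast_add_one_ne_zero j
  have hx : X k (j + 1) - prevTerm (X k) j
      = (X k (j + 1) - prevTerm (X k) j) / (2 * (j : ℂ) + 1) * (2 * (j : ℂ) + 1) := by
    field_simp
  rw [LogEntryRec] at h
  linear_combination hx + Complex.I * (2 * (j : ℂ) + 1) * h
    + (2 * (j : ℂ) + 1) * ((X k (j + 1) - prevTerm (X k) j) / (2 * (j : ℂ) + 1)) * Complex.I_sq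

theorem LogEntryRec.eq_next_row {F X : Matrix ℕ ℕ ℂ} {k j : ℕ} (h : LogEntryRec F X k j) :
    X (k + 1) j = prevTerm (fun m => X m j) k + (2 * (k : ℂ) + 1) *
      (Complex.I * ((X k (j + 1) - prevTerm (X k) j) / (2 * (j : ℂ) + 1)) + F k j) := by
  have hk := two_mul_natCast_add_one_ne_zero k
  have hx : X (k + 1) j - prevTerm (fun m => X m j) k
      = (X (k + 1) j - prevTerm (fun m => X m j) k) / (2 * (k : ℂ) + 1) * (2 * (k : ℂ) + 1) := by
    field_simp
  rw [LogEntryRec] at h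
  linear_combination hx + (2 * (k : ℂ) + 1) * h

theorem StieltjesEntryRec.eq_next_column {z : ℂ} {X : Matrix ℕ ℕ ℂ} {k j : ℕ}
    (h : StieltjesEntryRec z X k j) :
    X k (j + 1) = Complex.I / ((j : ℂ) + 1) * (Complex.I * (j : ℂ) * prevTerm (X k) j
      + (2 * (j : ℂ) + 1) * ((((k : ℂ) + 1) * X (k + 1) j + (k : ℂ) * prevTerm (fun m => X m j) k)
        / (2 * (k : ℂ) + 1) - z * X k j)) := by
  rw [StieltjesEntryRec] at h
  rw [div_mul_eq_mul_div, eq_div_iff (natCast_add_one_ne_zero' j)]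
  generalize hc : (((j : ℂ) + 1) * X k (j + 1) + (j : ℂ) * prevTerm (X k) j)
    / (2 * (j : ℂ) + 1) = c at h
  rw [div_eq_iff (two_mul_natCast_add_one_ne_zero j)] at hc
  linear_combination (-Complex.I * (2 * (j : ℂ) + 1)) * h - Complex.I ^ 2 * hc
    + ((j : ℂ) + 1) * X k (j + 1) * Complex.I_sq

theorem StieltjesEntryRec.eq_next_row {z : ℂ} {X : Matrix ℕ ℕ ℂ} {k j : ℕ}
    (h : StieltjesEntryRec z X k j) :
    X (k + 1) j = -1 / ((k : ℂ) + 1) * ((k : ℂ) * prevTerm (fun m => X m j) k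
      + (2 * (k : ℂ) + 1) * (Complex.I * (((j : ℂ) + 1) * X k (j + 1) + (j : ℂ) * prevTerm (X k) j)
        / (2 * (j : ℂ) + 1) - z * X k j)) := by
  rw [StieltjesEntryRec] at h
  rw [mul_div_assoc Complex.I, div_mul_eq_mul_div, eq_div_iff (natCast_add_one_ne_zero' k)]
  generalize hc : (((k : ℂ) + 1) * X (k + 1) j + (k : ℂ) * prevTerm (fun m => X m j) k)
    / (2 * (k : ℂ) + 1) = c at h
  rw [div_eq_iff (two_mul_natCast_add_one_ne_zero k)] at hc
  linear_combination hc + (2 * (k : ℂ) + 1) * h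

/-- Induction on the column index: each column is a function of the two before it. -/
theorem LogEntryRec.unique {F X Y : Matrix ℕ ℕ ℂ} (hX : ∀ k j, LogEntryRec F X k j)
    (hY : ∀ k j, LogEntryRec F Y k j) (h0 : ∀ k, X k 0 = Y k 0) : X = Y := by
  have key : ∀ j k, X k j = Y k j := by
    intro j
    induction j using Nat.strong_induction_on with
    | _ j ih =>
      cases j with
      | zero => exact h0
      | succ j =>
        intro k
        rw [(hX k j).eq_next_column, (hY k j).eq_next_column, ih j (by omega),
          prevTerm_congr (f := X k) fun m hm => ih m (by omega) k,
          prevTerm_congr (f := fun m => X m j) fun m _ => ih j (by omega) m]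
  ext k j
  exact key j k

/-- Induction on the row index. The identity is available only for `j > 0`, so column 0 of each new
row has to come from the given first column. -/
theorem StieltjesEntryRec.unique {z : ℂ} {X Y : Matrix ℕ ℕ ℂ}
    (hX : ∀ k j, 0 < j → StieltjesEntryRec z X k j)
    (hY : ∀ k j, 0 < j → StieltjesEntryRec z Y k j) (h0 : ∀ k, X k 0 = Y k 0)
    (h1 : ∀ j, X 0 j = Y 0 j) : X = Y := by
  have key : ∀ k j, X k j = Y k j := by
    intro k
    induction k using Nat.strong_induction_on with
    | _ k ih =>
      cases k with
      | zero => exact h1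
      | succ k =>
        intro j
        rcases Nat.eq_zero_or_pos j with rfl | hj
        · exact h0 _
        rw [(hX k j hj).eq_next_row, (hY k j hj).eq_next_row, ih k (by omega), ih k (by omega),
          prevTerm_congr (f := X k) fun m hm => ih k (by omega) m,
          prevTerm_congr (f := fun m => X m j) fun m _ => ih m (by omega) j]
  ext k j
  exact key k j

/-- Forward substitution is correct as soon as each step is, given all entries of total degree at
most `p` in the rows and columns of smaller index. -/
theorem fillSteps_firstRowColumn (nextColumn nextRow : Matrix ℕ ℕ ℂ → ℕ → ℕ → ℂ) (p : ℕ)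
    (Y : Matrix ℕ ℕ ℂ)
    (hcol : ∀ (l k : ℕ) (Z : Matrix ℕ ℕ ℂ), l + 1 ≤ k → k + l + 1 ≤ p →
      (∀ a b, a + b ≤ p → b ≤ l → Z a b = Y a b) → nextColumn Z l k = Y k (l + 1))
    (hrow : ∀ (l j : ℕ) (Z : Matrix ℕ ℕ ℂ), l + 2 ≤ j → j + l + 1 ≤ p →
      (∀ a b, a + b ≤ p → a ≤ l → Z a b = Y a b) → nextRow Z l j = Y (l + 1) j) :
    fillSteps nextColumn nextRow p (firstRowColumn p Y) (p / 2) = truncDegree p Y := by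
  -- Invariant: after `n` steps rows and columns `0, …, n` are correct up to degree `p`, and all
  -- other entries are still zero.
  have inv : ∀ n, ∀ k j, fillSteps nextColumn nextRow p (firstRowColumn p Y) n k j
      = if k + j ≤ p ∧ (k ≤ n ∨ j ≤ n) then Y k j else 0 := by
    intro n
    induction n with
    | zero =>
      intro k j
      simp only [fillSteps, firstRowColumn, Matrix.of_apply]
      exact if_congr (by omega) rfl rfl
    | succ l ih =>
      intro k j
      rw [fillSteps]
      set Z := fillSteps nextColumn nextRow p (firstRowColumn p Y) l
      have hZ' : ∀ a b, fillColumn nextColumn p l Z a b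
          = if a + b ≤ p ∧ (a ≤ l ∨ b ≤ l ∨ b = l + 1) then Y a b else 0 := by
        intro a b
        simp only [fillColumn, Matrix.of_apply]
        by_cases h : b = l + 1 ∧ l + 1 ≤ a ∧ a + l + 1 ≤ p
        · rw [if_pos h, if_pos (by omega), hcol l a Z h.2.1 h.2.2, h.1]
          intro a b h1 h2
          rw [ih, if_pos ⟨h1, Or.inr h2⟩]
        · rw [if_neg h, ih]
          exact if_congr (by omega) rfl rfl
      generalize fillColumn nextColumn p l Z = Z' at hZ'
      simp only [fillRow, Matrix.of_apply]
      by_cases h : k = l + 1 ∧ l + 2 ≤ j ∧ j + l + 1 ≤ p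
      · rw [if_pos h, if_pos (by omega), hrow l j Z' h.2.1 h.2.2, h.1]
        intro a b h1 h2
        rw [hZ', if_pos ⟨h1, Or.inl h2⟩]
      · rw [if_neg h, hZ']
        exact if_congr (by omega) rfl rfl
  ext k j
  -- If `k + j ≤ p`, then one of `k`, `j` is at most `p / 2`, so the invariant covers the whole
  -- triangle.
  rw [inv, truncDegree, Matrix.of_apply]
  exact if_congr (by omega) rfl rfl

theorem logAlgorithm_eq {F Y : Matrix ℕ ℕ ℂ} (h : ∀ k j, LogEntryRec F Y k j) (p : ℕ) :
    logAlgorithm p (truncDegree p F) (firstRowColumn p Y) = truncDegree p Y := by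
  apply fillSteps_firstRowColumn
  · intro l k Z h1 h2 hZ
    have hv : mulV Z (e (l : ℤ)) = fun m => Z m l := funext fun m => mulV_e_nat Z l m
    simp only [logNextColumn, Pi.sub_apply, Pi.smul_apply, smul_eq_mul, mulV_e_nat_sub_one,
      mulV_e_nat, mulV_matC, hv]
    -- The farthest entry needed, `(k + 1, l)`, has the same total degree as the target `(k, l +
    -- 1)`.
    rw [(h k l).eq_next_column, hZ (k + 1) l (by omega) le_rfl,
      prevTerm_congr (f := Z k) fun m hm => hZ k m (by omega) (by omega),
      prevTerm_congr (f := fun m => Z m l) fun m _ => hZ m l (by omega) le_rfl,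
      truncDegree, Matrix.of_apply, if_pos (by omega)]
  · intro l j Z h1 h2 hZ
    have hv : mulV Z.transpose (e (l : ℤ)) = Z l := funext fun m => mulV_e_nat _ l m
    have ht : Z.transpose j = fun m => Z m j := rfl
    simp only [logNextRow, Pi.add_apply, Pi.smul_apply, smul_eq_mul, mulV_e_nat_sub_one,
      mulV_e_nat, mulV_matC, hv, ht, Matrix.transpose_apply]
    rw [(h l j).eq_next_row, hZ l (j + 1) (by omega) le_rfl,
      prevTerm_congr (f := Z l) fun m hm => hZ l m (by omega) (by omega),
      prevTerm_congr (f := fun m => Z m j) fun m _ => hZ m j (by omega) (by omega),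
      truncDegree, Matrix.of_apply, if_pos (by omega)]

/-- Column steps fill only `k ≥ l + 1` and row steps only `j ≥ l + 2`, so the exceptional identity
at `(0, 0)` is never used; this justifies step `l = 0`. -/
theorem stieltjesAlgorithm_eq {z : ℂ} {Y : Matrix ℕ ℕ ℂ}
    (h : ∀ k j, 0 < k ∨ 0 < j → StieltjesEntryRec z Y k j) (p : ℕ) :
    stieltjesAlgorithm p z (firstRowColumn p Y) = truncDegree p Y := by
  apply fillSteps_firstRowColumn
  · intro l k Z h1 h2 hZ
    have hv : mulV Z (e (l : ℤ)) = fun m => Z m l := funext fun m => mulV_e_nat Z l m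
    simp only [stieltjesNextColumn, Pi.add_apply, Pi.smul_apply, smul_eq_mul, mulV_e_nat_sub_one,
      mulV_matB_sub, hv]
    rw [(h k l (by omega)).eq_next_column, hZ (k + 1) l (by omega) le_rfl,
      hZ k l (by omega) le_rfl,
      prevTerm_congr (f := Z k) fun m hm => hZ k m (by omega) (by omega),
      prevTerm_congr (f := fun m => Z m l) fun m _ => hZ m l (by omega) le_rfl]
  · intro l j Z h1 h2 hZ
    have hv : mulV Z.transpose (e (l : ℤ)) = Z l := funext fun m => mulV_e_nat _ l m
    have ht : Z.transpose j = fun m => Z m j := rfl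
    simp only [stieltjesNextRow, Pi.add_apply, Pi.smul_apply, smul_eq_mul, mulV_e_nat_sub_one,
      mulV_smul_matB_sub, hv, ht]
    rw [(h l j (by omega)).eq_next_row, hZ l (j + 1) (by omega) le_rfl,
      hZ l j (by omega) le_rfl,
      prevTerm_congr (f := Z l) fun m hm => hZ l m (by omega) (by omega),
      prevTerm_congr (f := fun m => Z m j) fun m _ => hZ m j (by omega) (by omega)]

/-! ### Integrability -/

theorem integrableOn_abs_sub_rpow_neg_half (c : ℝ) :
    IntegrableOn (fun s : ℝ => |c - s| ^ (-1 / 2 : ℝ)) (Set.Icc (-1) 1) := by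
  -- For a negative base the real power carries the factor `cos(-π/2) = 0`, and `0 ^ (-1/2) = 0`, so
  -- at most one summand is nonzero.
  have habs : ∀ u : ℝ, |u| ^ (-1 / 2 : ℝ) = u ^ (-1 / 2 : ℝ) + (-u) ^ (-1 / 2 : ℝ) := by
    have hneg : ∀ u : ℝ, u < 0 → u ^ (-1 / 2 : ℝ) = 0 := by
      intro u hu
      rw [Real.rpow_def_of_neg hu, show (-1 / 2 : ℝ) * Real.pi = -(Real.pi / 2) by ring,
        Real.cos_neg, Real.cos_pi_div_two, mul_zero]
    intro u
    rcases lt_trichotomy u 0 with hu | rfl | hu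
    · rw [abs_of_neg hu, hneg u hu, zero_add]
    · simp [Real.zero_rpow]
    · rw [abs_of_pos hu, hneg (-u) (by linarith), add_zero]
  have h1 : ∀ a b : ℝ, IntervalIntegrable (fun u : ℝ => |u| ^ (-1 / 2 : ℝ)) volume a b := by
    intro a b
    have h2 : ∀ a b : ℝ, IntervalIntegrable (fun u : ℝ => u ^ (-1 / 2 : ℝ)) volume a b :=
      fun a b => intervalIntegral.intervalIntegrable_rpow' (by norm_num)
    have h3 : IntervalIntegrable (fun u : ℝ => (-u) ^ (-1 / 2 : ℝ)) volume a b := by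
      simpa using (h2 (-a) (-b)).comp_sub_left 0
    simp only [habs]
    exact (h2 a b).add h3
  have h4 : IntervalIntegrable (fun s : ℝ => |c - s| ^ (-1 / 2 : ℝ)) volume (-1) 1 := by
    simpa using (h1 (c - -1) (c - 1)).comp_sub_left c
  exact (intervalIntegrable_iff_integrableOn_Icc_of_le (by norm_num)).1 h4

/-- Splitting `|w|⁻¹` into two square roots bounds the kernel by a product of integrable functions
of one variable each. -/
theorem norm_inv_le_rpow {w : ℂ} (hre : w.re ≠ 0) (him : w.im ≠ 0) :
    ‖w⁻¹‖ ≤ |w.re| ^ (-1 / 2 : ℝ) * |w.im| ^ (-1 / 2 : ℝ) := by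
  have hw : 0 < ‖w‖ := norm_pos_iff.2 fun h => hre (by simp [h])
  have h1 : ∀ {u : ℝ}, 0 < u → u ≤ ‖w‖ → ‖w‖ ^ (-1 / 2 : ℝ) ≤ u ^ (-1 / 2 : ℝ) :=
    fun hu h => Real.rpow_le_rpow_of_nonpos hu h (by norm_num)
  calc ‖w⁻¹‖ = ‖w‖ ^ (-1 / 2 : ℝ) * ‖w‖ ^ (-1 / 2 : ℝ) := by
        rw [← Real.rpow_add hw, norm_inv, ← Real.rpow_neg_one]; norm_num
    _ ≤ _ := mul_le_mul (h1 (abs_pos.2 hre) (Complex.abs_re_le_norm w))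
        (h1 (abs_pos.2 him) (Complex.abs_im_le_norm w)) (by positivity) (by positivity)

/-- Both bounds on `log |w|` come from `log r ≤ r`, taken at `r = |w|` and `r = |w|^(-1/2)`; `π`
bounds the argument. In use, `u` is `|re w|` or `|im w|`. -/
theorem norm_log_le_rpow {w : ℂ} {u : ℝ} (hu : 0 < u) (huw : u ≤ ‖w‖) :
    ‖Complex.log w‖ ≤ ‖w‖ + 2 * u ^ (-1 / 2 : ℝ) + Real.pi := by
  have hw : 0 < ‖w‖ := hu.trans_le huw
  have h1 : |Real.log ‖w‖| ≤ ‖w‖ + 2 * ‖w‖ ^ (-1 / 2 : ℝ) := by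
    have h2 : 0 ≤ ‖w‖ ^ (-1 / 2 : ℝ) := by positivity
    rw [abs_le]
    constructor
    · have h3 := Real.log_le_self h2
      rw [Real.log_rpow hw] at h3
      linarith
    · linarith [Real.log_le_self hw.le]
  have h2 : ‖w‖ ^ (-1 / 2 : ℝ) ≤ u ^ (-1 / 2 : ℝ) :=
    Real.rpow_le_rpow_of_nonpos hu huw (by norm_num)
  have h3 := Complex.norm_le_abs_re_add_abs_im (Complex.log w)
  rw [Complex.log_re, Complex.log_im] at h3
  linarith [Complex.abs_arg_le_pi w]

theorem ae_ne (c : ℝ) : ∀ᵐ s : ℝ, s ≠ c := by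
  simp [ae_iff, measure_singleton]

theorem restrict_square :
    (volume : Measure (ℝ × ℝ)).restrict square
      = (volume.restrict (Set.Icc (-1 : ℝ) 1)).prod (volume.restrict (Set.Icc (-1 : ℝ) 1)) := by
  rw [Measure.prod_restrict, square, Measure.volume_eq_prod]

theorem ae_fst_ne (c : ℝ) : ∀ᵐ p : ℝ × ℝ ∂volume.restrict square, p.1 ≠ c := by
  apply ae_restrict_of_ae
  rw [Measure.volume_eq_prod]
  exact Measure.quasiMeasurePreserving_fst.ae (ae_ne c)

theorem ae_snd_ne (c : ℝ) : ∀ᵐ p : ℝ × ℝ ∂volume.restrict square, p.2 ≠ c := by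
  apply ae_restrict_of_ae
  rw [Measure.volume_eq_prod]
  exact Measure.quasiMeasurePreserving_snd.ae (ae_ne c)

theorem isCompact_square : IsCompact square := isCompact_Icc.prod isCompact_Icc

theorem measurable_sub_point (z : ℂ) :
    Measurable fun p : ℝ × ℝ => z - ((p.1 : ℂ) + Complex.I * (p.2 : ℂ)) :=
  Continuous.measurable (by fun_prop)

theorem integrableOn_inv (z : ℂ) :
    IntegrableOn (fun p : ℝ × ℝ => (z - ((p.1 : ℂ) + Complex.I * (p.2 : ℂ)))⁻¹) square := by
  have h : Integrable (fun p : ℝ × ℝ => |z.re - p.1| ^ (-1 / 2 : ℝ) * |z.im - p.2| ^ (-1 / 2 : ℝ))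
      (volume.restrict square) := by
    rw [restrict_square]
    exact (integrableOn_abs_sub_rpow_neg_half z.re).mul_prod
      (integrableOn_abs_sub_rpow_neg_half z.im)
  refine h.mono' (measurable_sub_point z).inv.aestronglyMeasurable ?_
  filter_upwards [ae_fst_ne z.re, ae_snd_ne z.im] with p h1 h2
  have hre : (z - ((p.1 : ℂ) + Complex.I * (p.2 : ℂ))).re = z.re - p.1 := by simp
  have him : (z - ((p.1 : ℂ) + Complex.I * (p.2 : ℂ))).im = z.im - p.2 := by simp
  rw [← hre, ← him]
  exact norm_inv_le_rpow (by rw [hre]; exact sub_ne_zero.2 h1.symm)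
    (by rw [him]; exact sub_ne_zero.2 h2.symm)

theorem integrableOn_log (z : ℂ) :
    IntegrableOn (fun p : ℝ × ℝ => Complex.log (z - ((p.1 : ℂ) + Complex.I * (p.2 : ℂ))))
      square := by
  have h1 : IntegrableOn (fun p : ℝ × ℝ => ‖z - ((p.1 : ℂ) + Complex.I * (p.2 : ℂ))‖) square :=
    ContinuousOn.integrableOn_compact isCompact_square (Continuous.continuousOn (by fun_prop))
  have h2 : Integrable (fun p : ℝ × ℝ => |z.re - p.1| ^ (-1 / 2 : ℝ)) (volume.restrict square) := by
    rw [restrict_square]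
    exact (integrableOn_abs_sub_rpow_neg_half z.re).comp_fst _
  have h3 : IntegrableOn (fun _ : ℝ × ℝ => Real.pi) square :=
    ContinuousOn.integrableOn_compact isCompact_square continuousOn_const
  refine ((h1.add (h2.const_mul 2)).add h3).mono'
    (Complex.measurable_log.comp (measurable_sub_point z)).aestronglyMeasurable ?_
  filter_upwards [ae_fst_ne z.re] with p hp
  have hre : (z - ((p.1 : ℂ) + Complex.I * (p.2 : ℂ))).re = z.re - p.1 := by simp
  refine norm_log_le_rpow (abs_pos.2 (sub_ne_zero.2 hp.symm)) ?_
  rw [← hre]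
  exact Complex.abs_re_le_norm _

theorem integrableOn_log_sub_ofReal (c : ℂ) :
    IntegrableOn (fun s : ℝ => Complex.log (c - (s : ℂ))) (Set.Icc (-1) 1) := by
  have h1 : IntegrableOn (fun s : ℝ => ‖c - (s : ℂ)‖) (Set.Icc (-1) 1) :=
    ContinuousOn.integrableOn_compact isCompact_Icc (Continuous.continuousOn (by fun_prop))
  have h2 := integrableOn_abs_sub_rpow_neg_half c.re
  have h3 : IntegrableOn (fun _ : ℝ => Real.pi) (Set.Icc (-1 : ℝ) 1) :=
    ContinuousOn.integrableOn_compact isCompact_Icc continuousOn_const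
  refine ((h1.add (h2.const_mul 2)).add h3).mono'
    (Complex.measurable_log.comp (Continuous.measurable (by fun_prop))).aestronglyMeasurable ?_
  filter_upwards [ae_restrict_of_ae (ae_ne c.re)] with s hs
  refine norm_log_le_rpow (abs_pos.2 (sub_ne_zero.2 hs.symm)) ?_
  simpa using Complex.abs_re_le_norm (c - (s : ℂ))

theorem integrableOn_log_sub_I_mul_ofReal (c : ℂ) :
    IntegrableOn (fun t : ℝ => Complex.log (c - Complex.I * (t : ℂ))) (Set.Icc (-1) 1) := by
  have h1 : IntegrableOn (fun t : ℝ => ‖c - Complex.I * (t : ℂ)‖) (Set.Icc (-1) 1) :=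
    ContinuousOn.integrableOn_compact isCompact_Icc (Continuous.continuousOn (by fun_prop))
  have h2 := integrableOn_abs_sub_rpow_neg_half c.im
  have h3 : IntegrableOn (fun _ : ℝ => Real.pi) (Set.Icc (-1 : ℝ) 1) :=
    ContinuousOn.integrableOn_compact isCompact_Icc continuousOn_const
  refine ((h1.add (h2.const_mul 2)).add h3).mono'
    (Complex.measurable_log.comp (Continuous.measurable (by fun_prop))).aestronglyMeasurable ?_
  filter_upwards [ae_restrict_of_ae (ae_ne c.im)] with t ht
  refine norm_log_le_rpow (abs_pos.2 (sub_ne_zero.2 ht.symm)) ?_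
  simpa using Complex.abs_im_le_norm (c - Complex.I * (t : ℂ))

/-! ### Fubini on the square. -/

theorem setIntegral_square {f : ℝ × ℝ → ℂ} (hf : IntegrableOn f square) :
    ∫ p in square, f p = ∫ s in Set.Icc (-1 : ℝ) 1, ∫ t in Set.Icc (-1 : ℝ) 1, f (s, t) := by
  rw [IntegrableOn, restrict_square] at hf
  rw [restrict_square, integral_prod f hf]

theorem setIntegral_square_symm {f : ℝ × ℝ → ℂ} (hf : IntegrableOn f square) :
    ∫ p in square, f p = ∫ t in Set.Icc (-1 : ℝ) 1, ∫ s in Set.Icc (-1 : ℝ) 1, f (s, t) := by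
  rw [IntegrableOn, restrict_square] at hf
  rw [restrict_square, integral_prod_symm f hf]

theorem setIntegral_Icc_eq (f : ℝ → ℂ) :
    ∫ s in Set.Icc (-1 : ℝ) 1, f s = ∫ s in (-1 : ℝ)..1, f s := by
  rw [integral_Icc_eq_integral_Ioc, intervalIntegral.integral_of_le (by norm_num)]

/-! ### Integration by parts along lines -/

theorem hasDerivAt_ofReal_legendreQ (k : ℕ) (x : ℝ) :
    HasDerivAt (fun s : ℝ => (legendreQ k s : ℂ)) (legendreP k x : ℂ) x :=
  (hasDerivAt_legendreQ k x).ofReal_comp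

theorem continuous_ofReal_legendreP (k : ℕ) : Continuous fun s : ℝ => (legendreP k s : ℂ) :=
  Complex.continuous_ofReal.comp (continuous_legendreP k)

theorem continuous_ofReal_legendreQ (k : ℕ) : Continuous fun s : ℝ => (legendreQ k s : ℂ) :=
  Complex.continuous_ofReal.comp (continuous_legendreQ k)

/-- Serves all lines off the cut: `b = -1` horizontally, `b = -i` vertically, and `b = i` after the
reflection `w ↦ -w`. -/
theorem integral_log_affine_mul_legendreP (a b : ℂ) (k : ℕ)
    (h : ∀ s : ℝ, a + b * (s : ℂ) ∈ Complex.slitPlane) :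
    ∫ s in (-1 : ℝ)..1, Complex.log (a + b * (s : ℂ)) * (legendreP k s : ℂ)
      = Complex.log (a + b) * (legendreQ k 1 : ℂ) - Complex.log (a - b) * (legendreQ k (-1) : ℂ)
        - b * ∫ s in (-1 : ℝ)..1, (a + b * (s : ℂ))⁻¹ * (legendreQ k s : ℂ) := by
  have hd : ∀ s : ℝ, HasDerivAt (fun s : ℝ => a + b * (s : ℂ)) b s := by
    intro s
    simpa using ((Complex.ofRealCLM.hasDerivAt (x := s)).const_mul b).const_add a
  have hc : Continuous fun s : ℝ => b / (a + b * (s : ℂ)) :=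
    continuous_const.div (by fun_prop) fun s => Complex.slitPlane_ne_zero (h s)
  rw [intervalIntegral.integral_mul_deriv_eq_deriv_mul
    (fun s _ => (hd s).clog_real (h s)) (fun s _ => hasDerivAt_ofReal_legendreQ k s)
    (hc.intervalIntegrable _ _) ((continuous_ofReal_legendreP k).intervalIntegrable _ _),
    ← intervalIntegral.integral_const_mul]
  congr 1
  · push_cast
    rw [mul_one, mul_neg_one, ← sub_eq_add_neg]
  · refine intervalIntegral.integral_congr fun s _ => ?_
    simp only [div_eq_mul_inv, mul_assoc]

theorem integral_log_horizontal (z : ℂ) {t : ℝ} (ht : t ≠ z.im) (k : ℕ) :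
    ∫ s in (-1 : ℝ)..1, Complex.log (z - ((s : ℂ) + Complex.I * (t : ℂ))) * (legendreP k s : ℂ)
      = Complex.log (z - 1 - Complex.I * (t : ℂ)) * (legendreQ k 1 : ℂ)
        - Complex.log (z + 1 - Complex.I * (t : ℂ)) * (legendreQ k (-1) : ℂ)
        + ∫ s in (-1 : ℝ)..1,
            (z - ((s : ℂ) + Complex.I * (t : ℂ)))⁻¹ * (legendreQ k s : ℂ) := by
  have hw : ∀ s : ℝ, z - ((s : ℂ) + Complex.I * (t : ℂ))
      = (z - Complex.I * (t : ℂ)) + (-1) * (s : ℂ) := fun s => by ring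
  simp only [hw]
  rw [integral_log_affine_mul_legendreP]
  · rw [show z - Complex.I * (t : ℂ) + -1 = z - 1 - Complex.I * (t : ℂ) by ring,
      show z - Complex.I * (t : ℂ) - -1 = z + 1 - Complex.I * (t : ℂ) by ring]
    ring
  · intro s
    rw [Complex.mem_slitPlane_iff]
    right
    simpa [sub_eq_zero] using ht.symm

theorem integral_log_vertical_of_lt (z : ℂ) {s : ℝ} (hs : s < z.re) (j : ℕ) :
    ∫ t in (-1 : ℝ)..1, Complex.log (z - ((s : ℂ) + Complex.I * (t : ℂ))) * (legendreP j t : ℂ)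
      = Complex.log (z - Complex.I - (s : ℂ)) * (legendreQ j 1 : ℂ)
        - Complex.log (z + Complex.I - (s : ℂ)) * (legendreQ j (-1) : ℂ)
        + Complex.I * ∫ t in (-1 : ℝ)..1,
            (z - ((s : ℂ) + Complex.I * (t : ℂ)))⁻¹ * (legendreQ j t : ℂ) := by
  have hw : ∀ t : ℝ, z - ((s : ℂ) + Complex.I * (t : ℂ))
      = (z - (s : ℂ)) + (-Complex.I) * (t : ℂ) := fun t => by ring
  simp only [hw]
  rw [integral_log_affine_mul_legendreP]
  · rw [show z - (s : ℂ) + -Complex.I = z - Complex.I - (s : ℂ) by ring,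
      show z - (s : ℂ) - -Complex.I = z + Complex.I - (s : ℂ) by ring]
    ring
  · intro t
    rw [Complex.mem_slitPlane_iff]
    left
    simpa using hs

/-! ### Vertical lines that may cross the branch cut. -/

theorem log_eq_log_neg_add {w : ℂ} (hw : w.re < 0) :
    Complex.log w = Complex.log (-w) + Complex.I * Real.pi * (if 0 ≤ w.im then 1 else -1) := by
  simp only [Complex.log, norm_neg]
  split_ifs with h
  · have h1 : (-w).arg = w.arg - Real.pi := by
      rw [Complex.arg_neg_eq_arg_sub_pi_iff]
      rcases h.lt_or_eq with h | h
      · exact Or.inl h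
      · exact Or.inr ⟨h.symm, hw⟩
    rw [h1]; push_cast; ring
  · have h1 : (-w).arg = w.arg + Real.pi := by
      rw [Complex.arg_neg_eq_arg_add_pi_iff]
      exact Or.inl (not_le.1 h)
    rw [h1]; push_cast; ring

/-- The sign of the imaginary part of the logarithm along a vertical line that meets the branch
cut at height `y`. -/
def cutSign (y t : ℝ) : ℂ := if t ≤ y then 1 else -1

/-- The integral is split at `t = y`. At `y = -1` the sign is `+1` at the lower endpoint alone, and
the jump counts; at `y = 1` it is `+1` throughout, with no jump. Hence `-1 ≤ y < 1`. -/
theorem integral_cutSign_mul_legendreP (y : ℝ) (j : ℕ) :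
    IntervalIntegrable (fun t => cutSign y t * (legendreP j t : ℂ)) volume (-1) 1 ∧
    ∫ t in (-1 : ℝ)..1, cutSign y t * (legendreP j t : ℂ)
      = cutSign y 1 * (legendreQ j 1 : ℂ) - cutSign y (-1) * (legendreQ j (-1) : ℂ)
        + (if -1 ≤ y ∧ y < 1 then 2 * (legendreQ j y : ℂ) else 0) := by
  have hP : ∀ a b : ℝ, ∫ t in a..b, (legendreP j t : ℂ) = legendreQ j b - legendreQ j a :=
    fun a b => intervalIntegral.integral_eq_sub_of_hasDerivAt
      (fun x _ => hasDerivAt_ofReal_legendreQ j x)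
      ((continuous_ofReal_legendreP j).intervalIntegrable _ _)
  have hi := fun a b : ℝ => (continuous_ofReal_legendreP j).intervalIntegrable (μ := volume) a b
  have below : ∀ a b : ℝ, a ≤ b → b ≤ y →
      IntervalIntegrable (fun t => cutSign y t * (legendreP j t : ℂ)) volume a b ∧
      ∫ t in a..b, cutSign y t * (legendreP j t : ℂ) = legendreQ j b - legendreQ j a := by
    intro a b hab hb
    have h : Set.EqOn (fun t => (legendreP j t : ℂ)) (fun t => cutSign y t * (legendreP j t : ℂ))
        (Set.uIoc a b) := by
      intro t ht
      rw [Set.uIoc_of_le hab] at ht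
      simp [cutSign, ht.2.trans hb]
    refine ⟨(hi a b).congr h, ?_⟩
    rw [← hP]
    exact intervalIntegral.integral_congr_ae (Filter.Eventually.of_forall fun t ht => (h ht).symm)
  have above : ∀ a b : ℝ, a ≤ b → y ≤ a →
      IntervalIntegrable (fun t => cutSign y t * (legendreP j t : ℂ)) volume a b ∧
      ∫ t in a..b, cutSign y t * (legendreP j t : ℂ) = -(legendreQ j b - legendreQ j a) := by
    intro a b hab hb
    have h : Set.EqOn (fun t => -(legendreP j t : ℂ)) (fun t => cutSign y t * (legendreP j t : ℂ))
        (Set.uIoc a b) := by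
      intro t ht
      rw [Set.uIoc_of_le hab] at ht
      simp [cutSign, not_le.2 (hb.trans_lt ht.1)]
    refine ⟨(hi a b).neg.congr h, ?_⟩
    rw [← hP, ← intervalIntegral.integral_neg]
    exact intervalIntegral.integral_congr_ae (Filter.Eventually.of_forall fun t ht => (h ht).symm)
  rcases le_or_gt 1 y with h1 | h1
  · obtain ⟨h2, h3⟩ := below (-1) 1 (by norm_num) h1
    refine ⟨h2, ?_⟩
    rw [h3, if_neg (by intro h; linarith [h.2]), cutSign, cutSign, if_pos h1,
      if_pos (by linarith)]
    ring
  rcases lt_or_ge y (-1) with h2 | h2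
  · obtain ⟨h3, h4⟩ := above (-1) 1 (by norm_num) h2.le
    refine ⟨h3, ?_⟩
    rw [h4, if_neg (by intro h; linarith [h.1]), cutSign, cutSign, if_neg (by linarith),
      if_neg (by linarith)]
    ring
  · obtain ⟨h3, h4⟩ := below (-1) y h2 le_rfl
    obtain ⟨h5, h6⟩ := above y 1 h1.le le_rfl
    refine ⟨h3.trans h5, ?_⟩
    rw [← intervalIntegral.integral_add_adjacent_intervals h3 h5, h4, h6, if_pos ⟨h2, h1⟩,
      cutSign, cutSign, if_neg (by linarith), if_pos h2]
    ring

theorem log_sub_eq_log_neg_add_cutSign (z : ℂ) {s : ℝ} (hs : z.re < s) (t : ℝ) :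
    Complex.log (z - ((s : ℂ) + Complex.I * (t : ℂ)))
      = Complex.log ((s - z) + Complex.I * (t : ℂ)) + Complex.I * Real.pi * cutSign z.im t := by
  rw [log_eq_log_neg_add (by simpa using hs),
    show -(z - ((s : ℂ) + Complex.I * (t : ℂ))) = (s - z) + Complex.I * (t : ℂ) by ring, cutSign]
  congr 3
  simp

/-- With `log w = log(-w) ± iπ`, the logarithm of `-w` is smooth along the line and integrates by
parts. The signs at the endpoints restore the principal values there, and the jump at `t = y` is
left over. -/
theorem integral_log_vertical_of_gt (z : ℂ) {s : ℝ} (hs : z.re < s) (j : ℕ) :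
    ∫ t in (-1 : ℝ)..1, Complex.log (z - ((s : ℂ) + Complex.I * (t : ℂ))) * (legendreP j t : ℂ)
      = Complex.log (z - Complex.I - (s : ℂ)) * (legendreQ j 1 : ℂ)
        - Complex.log (z + Complex.I - (s : ℂ)) * (legendreQ j (-1) : ℂ)
        + Complex.I * (∫ t in (-1 : ℝ)..1,
            (z - ((s : ℂ) + Complex.I * (t : ℂ)))⁻¹ * (legendreQ j t : ℂ))
        + (if -1 ≤ z.im ∧ z.im < 1 then 2 * Complex.I * Real.pi * (legendreQ j z.im : ℂ) else 0) := by
  have hslit : ∀ t : ℝ, ((s : ℂ) - z) + Complex.I * (t : ℂ) ∈ Complex.slitPlane := by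
    intro t
    rw [Complex.mem_slitPlane_iff]
    left
    simpa using hs
  obtain ⟨hci, hc⟩ := integral_cutSign_mul_legendreP z.im j
  have hcont : Continuous fun t : ℝ =>
      Complex.log (((s : ℂ) - z) + Complex.I * (t : ℂ)) * (legendreP j t : ℂ) :=
    (Continuous.clog (by fun_prop) hslit).mul (continuous_ofReal_legendreP j)
  have hsplit : ∀ t : ℝ,
      Complex.log (z - ((s : ℂ) + Complex.I * (t : ℂ))) * (legendreP j t : ℂ)
        = Complex.log (((s : ℂ) - z) + Complex.I * (t : ℂ)) * (legendreP j t : ℂ)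
          + Complex.I * Real.pi * (cutSign z.im t * (legendreP j t : ℂ)) := by
    intro t
    rw [log_sub_eq_log_neg_add_cutSign z hs]
    ring
  have e1 := log_sub_eq_log_neg_add_cutSign z hs 1
  have e2 := log_sub_eq_log_neg_add_cutSign z hs (-1)
  push_cast at e1 e2
  rw [show z - ((s : ℂ) + Complex.I * 1) = z - Complex.I - (s : ℂ) by ring, mul_one] at e1
  rw [show z - ((s : ℂ) + Complex.I * -1) = z + Complex.I - (s : ℂ) by ring, mul_neg_one,
    ← sub_eq_add_neg] at e2
  have hinv : ∫ t in (-1 : ℝ)..1, (((s : ℂ) - z) + Complex.I * (t : ℂ))⁻¹ * (legendreQ j t : ℂ)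
      = -∫ t in (-1 : ℝ)..1, (z - ((s : ℂ) + Complex.I * (t : ℂ)))⁻¹ * (legendreQ j t : ℂ) := by
    rw [← intervalIntegral.integral_neg]
    refine intervalIntegral.integral_congr fun t _ => ?_
    rw [← neg_mul, ← inv_neg]
    congr 2
    ring
  simp only [hsplit]
  rw [intervalIntegral.integral_add (hcont.intervalIntegrable _ _) (hci.const_mul _),
    intervalIntegral.integral_const_mul, hc, integral_log_affine_mul_legendreP _ _ _ hslit, hinv,
    e1, e2]
  split_ifs <;> ring

/-! ### The inhomogeneity in closed form -/

/-- Height of the jump of `∫ log (z - (s + i t)) P_j(t) dt` as `s` crosses the branch cut. -/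
def cutCoeff (j : ℕ) (y : ℝ) : ℂ :=
  if -1 ≤ y ∧ y < 1 then 2 * Complex.I * (Real.pi : ℂ) * (legendreQ j y : ℂ) else 0

/-- The integral of `legendreQ k` over `{s ∈ [-1, 1] | x < s}`. -/
def cutIntegral (x : ℝ) (k : ℕ) : ℝ :=
  if x < -1 then legendreR k 1 - legendreR k (-1)
  else if x ≤ 1 then legendreR k 1 - legendreR k x
  else 0

theorem ultraC_neg_half_succ (j : ℕ) (y : ℝ) : ultraC (-1 / 2) (j + 1) y = -legendreQ j y := by
  rw [legendreQ, neg_neg]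

/-- `β` is the true cut contribution plus a correction in row 0, which cancels the cut parts of
`μ_j(z - 1)` and `μ_j(z + 1)` found in `muTerm_eq`. -/
theorem betaTerm_eq (k j : ℕ) (z : ℂ) :
    betaTerm k j z = cutCoeff j z.im * ((cutIntegral z.re k
      + if k = 0 then min (z.re - 1) 0 + min (z.re + 1) 0 else 0 : ℝ) : ℂ) := by
  rw [betaTerm, cutCoeff, ultraC_neg_half_succ]
  by_cases hy : -1 ≤ z.im ∧ z.im < 1
  swap
  · rw [if_neg (fun h => hy h.2.2), if_neg (fun h => hy h.2), if_neg hy]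
    simp
  rw [if_pos hy, cutIntegral, legendreR_one, legendreR_neg_one]
  have hR : ultraC (-3 / 2) (k + 2) z.re / 3 = legendreR k z.re := rfl
  rw [hR]
  by_cases h1 : z.re < -1
  · rw [if_neg (fun h => absurd h.1 (not_le.2 h1)), if_pos ⟨h1, hy⟩, if_pos h1,
      min_eq_left (by linarith), min_eq_left (by linarith)]
    split_ifs <;> first | omega | (push_cast; ring)
  rw [if_neg h1, if_neg (fun h : z.re < -1 ∧ _ => h1 h.1)]
  rw [min_eq_right (a := z.re + 1) (by linarith)]
  by_cases h2 : z.re ≤ 1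
  · rw [if_pos ⟨not_lt.1 h1, h2, hy⟩, if_pos h2, min_eq_left (by linarith)]
    split_ifs <;> first | omega | (push_cast; ring)
  · rw [if_neg (fun h => h2 h.2.1), if_neg h2, min_eq_right (by linarith)]
    simp

theorem mul_logMinus (w : ℂ) :
    w * logMinus w = w * Complex.log w
      - (if w.im = 0 then 2 * Complex.I * (Real.pi : ℂ) * (min w.re 0 : ℝ) else 0) := by
  rw [logMinus]
  by_cases h : w.im = 0
  · by_cases h2 : w.re < 0
    · have hw : w = (w.re : ℂ) := Complex.ext rfl (by simpa using h)
      have harg : w.arg = Real.pi := Complex.arg_eq_pi_iff.2 ⟨h2, h⟩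
      rw [if_pos ⟨h, h2⟩, if_pos h, min_eq_left h2.le, Complex.log, harg, ← hw]
      ring
    · rw [if_neg (fun h3 => h2 h3.2), if_pos h, min_eq_right (not_lt.1 h2)]
      simp
  · rw [if_neg (fun h3 => h h3.1), if_neg h, sub_zero]

/-- On the line `y = -1`, outside the strict range in the definition, `logMinus` supplies the jump
for `j = 0`; for `j ≥ 1` none is due because `Q_j(-1) = 0`. Together they give the range `-1 ≤ y <
1` of `cutCoeff`. -/
theorem muTerm_eq (j : ℕ) (z : ℂ) :
    muTerm j z = (if j = 0 then
        (z - Complex.I) * Complex.log (z - Complex.I) + (z + Complex.I) * Complex.log (z + Complex.I)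
      else if j = 1 then -2 * Complex.I / 3 else 0)
      + cutCoeff j z.im * (min z.re 0 : ℝ) := by
  have key : (if z.re < 0 ∧ -1 < z.im ∧ z.im < 1 then
        2 * Complex.I * (Real.pi : ℂ) * (z.re : ℂ) * ((ultraC (-1 / 2) (j + 1) z.im : ℝ) : ℂ)
      else 0) + (if j = 0 then
        (if z.im = -1 then 2 * Complex.I * (Real.pi : ℂ) * (min z.re 0 : ℝ) else 0) else 0)
      = -(cutCoeff j z.im * (min z.re 0 : ℝ)) := by
    rw [ultraC_neg_half_succ, cutCoeff]
    rcases le_or_gt 0 z.re with h | h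
    · rw [min_eq_right h, if_neg (fun h2 => absurd h2.1 (not_lt.2 h))]
      simp
    rw [min_eq_left h.le]
    by_cases hy : z.im = -1
    · have hn : ¬ (z.re < 0 ∧ -1 < z.im ∧ z.im < 1) := fun h2 => absurd h2.2.1 (by rw [hy]; simp)
      rw [if_neg hn, if_pos hy, if_pos (show -1 ≤ z.im ∧ z.im < 1 by rw [hy]; norm_num),
        hy, legendreQ_neg_one]
      split_ifs <;> push_cast <;> ring
    · have hiff : (z.re < 0 ∧ -1 < z.im ∧ z.im < 1) ↔ (-1 ≤ z.im ∧ z.im < 1) :=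
        ⟨fun h2 => ⟨h2.2.1.le, h2.2.2⟩, fun h2 => ⟨h, lt_of_le_of_ne h2.1 (Ne.symm hy), h2.2⟩⟩
      rw [if_congr hiff rfl rfl, if_neg hy]
      split_ifs <;> push_cast <;> ring
  rw [muTerm, mul_logMinus]
  have him : (z + Complex.I).im = 0 ↔ z.im = -1 := by
    simp [eq_neg_iff_add_eq_zero]
  have hre : (z + Complex.I).re = z.re := by simp
  rw [if_congr him rfl rfl, hre]
  rcases eq_or_ne j 0 with hj | hj
  · simp only [if_pos hj] at key ⊢
    linear_combination -key
  · simp only [if_neg hj] at key ⊢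
    linear_combination -key

/-- The corner terms of `F⁽¹⁾` and `F⁽²⁾` cancel up to the jump across the branch cut. -/
theorem FMatrix_apply (z : ℂ) (k j : ℕ) :
    FMatrix z k j
      = (if j = 0 then
          (logInt (k + 1) (z - Complex.I) - prevTerm (fun m => logInt m (z - Complex.I)) k)
            / (2 * (k : ℂ) + 1)
          + (logInt (k + 1) (z + Complex.I) - prevTerm (fun m => logInt m (z + Complex.I)) k)
            / (2 * (k : ℂ) + 1) else 0)
        + cutCoeff j z.im * (cutIntegral z.re k : ℂ)
        - Complex.I * (if k = 0 then
          (logIntI (j + 1) (z - 1) - prevTerm (fun m => logIntI m (z - 1)) j) / (2 * (j : ℂ) + 1)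
          + (logIntI (j + 1) (z + 1) - prevTerm (fun m => logIntI m (z + 1)) j)
            / (2 * (j : ℂ) + 1) else 0) := by
  have h1 : (z - 1).im = z.im := by simp
  have h2 : (z + 1).im = z.im := by simp
  have h3 : (z - 1).re = z.re - 1 := by simp
  have h4 : (z + 1).re = z.re + 1 := by simp
  simp only [FMatrix, F1, F2, Matrix.sub_apply, Matrix.of_apply, betaTerm_eq, muTerm_eq, h1, h2,
    h3, h4, lambdaTerm]
  push_cast
  -- At `(1, 0)` two terms `λ_1 = -2/3` cancel the `-4/3`, and at `(0, 1)` two terms `μ_1` cancel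
  -- the `-4i/3`; at `(0, 0)` the logarithms at the four corners cancel.
  rcases k with _ | _ | k <;> rcases j with _ | _ | j
  · simp only [if_true]
    rw [show z - Complex.I - 1 = z - 1 - Complex.I by ring,
      show z - Complex.I + 1 = z + 1 - Complex.I by ring,
      show z + Complex.I - 1 = z - 1 + Complex.I by ring,
      show z + Complex.I + 1 = z + 1 + Complex.I by ring]
    push_cast
    ring
  all_goals
    simp
    try ring

/-! ### Logarithmic integrals -/

theorem legendreQ_succ_eq_div (k : ℕ) (x : ℝ) :
    (legendreQ (k + 1) x : ℂ)
      = ((legendreP (k + 2) x : ℂ) - legendreP k x) / (2 * ((k + 1 : ℕ) : ℂ) + 1) := by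
  rw [eq_div_iff (two_mul_natCast_add_one_ne_zero _)]
  have h := two_mul_add_one_mul_legendreQ_succ k x
  have h2 : (2 * (k : ℂ) + 3) * legendreQ (k + 1) x = legendreP (k + 2) x - legendreP k x := by
    exact_mod_cast h
  rw [← h2]
  push_cast
  ring

/-- The map `f` is the identity for the edge integrals and a coordinate projection for the double
integrals. The case `k = 0` agrees because `Q_0 = P_1` and `P_{-1} = 0`. -/
theorem integral_mul_legendreQ {α : Type*} [MeasurableSpace α] {μ : Measure α} {g : α → ℂ}
    {f : α → ℝ} (hi : ∀ k, Integrable (fun a => g a * (legendreP k (f a) : ℂ)) μ) (k : ℕ) :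
    ((∫ a, g a * (legendreP (k + 1) (f a) : ℂ) ∂μ)
        - prevTerm (fun m => ∫ a, g a * (legendreP m (f a) : ℂ) ∂μ) k) / (2 * (k : ℂ) + 1)
      = ∫ a, g a * (legendreQ k (f a) : ℂ) ∂μ := by
  cases k with
  | zero =>
    simp only [prevTerm, legendreQ_zero, legendreP]
    simp
  | succ n =>
    simp only [prevTerm, legendreQ_succ_eq_div]
    rw [← integral_sub (hi _) (hi _), ← integral_div]
    congr 1
    funext a
    ring

theorem logInt_eq (k : ℕ) (z : ℂ) :
    logInt k z = ∫ t in Set.Icc (-1 : ℝ) 1, Complex.log (z - (t : ℂ)) * (legendreP k t : ℂ) := by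
  rw [setIntegral_Icc_eq, logInt]

theorem logIntI_eq (k : ℕ) (z : ℂ) :
    logIntI k z = ∫ t in Set.Icc (-1 : ℝ) 1,
      Complex.log (z - Complex.I * (t : ℂ)) * (legendreP k t : ℂ) := by
  rw [setIntegral_Icc_eq, logIntI]

theorem logInt_sub_div (k : ℕ) (z : ℂ) :
    (logInt (k + 1) z - prevTerm (fun m => logInt m z) k) / (2 * (k : ℂ) + 1)
      = ∫ t in Set.Icc (-1 : ℝ) 1, Complex.log (z - (t : ℂ)) * (legendreQ k t : ℂ) := by
  simp only [logInt_eq]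
  exact integral_mul_legendreQ (f := fun t => t)
    (fun k => (integrableOn_log_sub_ofReal z).mul_continuousOn
      (continuous_ofReal_legendreP k).continuousOn isCompact_Icc) k

theorem logIntI_sub_div (k : ℕ) (z : ℂ) :
    (logIntI (k + 1) z - prevTerm (fun m => logIntI m z) k) / (2 * (k : ℂ) + 1)
      = ∫ t in Set.Icc (-1 : ℝ) 1,
          Complex.log (z - Complex.I * (t : ℂ)) * (legendreQ k t : ℂ) := by
  simp only [logIntI_eq]
  exact integral_mul_legendreQ (f := fun t => t)
    (fun k => (integrableOn_log_sub_I_mul_ofReal z).mul_continuousOn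
      (continuous_ofReal_legendreP k).continuousOn isCompact_Icc) k

theorem integrableOn_mul_of_continuous {g : ℝ × ℝ → ℂ} (hg : IntegrableOn g square)
    {a b : ℝ → ℂ} (ha : Continuous a) (hb : Continuous b) :
    IntegrableOn (fun p => g p * (a p.1 * b p.2)) square :=
  hg.mul_continuousOn ((ha.comp continuous_fst).mul (hb.comp continuous_snd)).continuousOn
    isCompact_square

theorem logMatrix_sub_div_fst (z : ℂ) (k j : ℕ) :
    (logMatrix z (k + 1) j - prevTerm (fun m => logMatrix z m j) k) / (2 * (k : ℂ) + 1)
      = ∫ p in square, Complex.log (z - ((p.1 : ℂ) + Complex.I * (p.2 : ℂ)))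
          * ((legendreQ k p.1 : ℂ) * (legendreP j p.2 : ℂ)) := by
  have h := integral_mul_legendreQ (μ := volume.restrict square) (f := Prod.fst)
    (g := fun p => Complex.log (z - ((p.1 : ℂ) + Complex.I * (p.2 : ℂ))) * (legendreP j p.2 : ℂ))
    (fun k => (integrableOn_mul_of_continuous (integrableOn_log z) (continuous_ofReal_legendreP k)
      (continuous_ofReal_legendreP j)).congr (Filter.Eventually.of_forall fun p => by
        dsimp only; ring)) k
  simp only [mul_assoc, mul_comm (legendreP j _ : ℂ)] at h
  simpa only [logMatrix, Matrix.of_apply, Complex.ofReal_mul] using h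

theorem logMatrix_sub_div_snd (z : ℂ) (k j : ℕ) :
    (logMatrix z k (j + 1) - prevTerm (logMatrix z k) j) / (2 * (j : ℂ) + 1)
      = ∫ p in square, Complex.log (z - ((p.1 : ℂ) + Complex.I * (p.2 : ℂ)))
          * ((legendreP k p.1 : ℂ) * (legendreQ j p.2 : ℂ)) := by
  have h := integral_mul_legendreQ (μ := volume.restrict square) (f := Prod.snd)
    (g := fun p => Complex.log (z - ((p.1 : ℂ) + Complex.I * (p.2 : ℂ))) * (legendreP k p.1 : ℂ))
    (fun j => (integrableOn_mul_of_continuous (integrableOn_log z) (continuous_ofReal_legendreP k)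
      (continuous_ofReal_legendreP j)).congr (Filter.Eventually.of_forall fun p => by
        dsimp only; ring)) j
  simp only [mul_assoc] at h
  have hX : logMatrix z k = fun m => ∫ p in square,
      Complex.log (z - ((p.1 : ℂ) + Complex.I * (p.2 : ℂ)))
        * ((legendreP k p.1 : ℂ) * (legendreP m p.2 : ℂ)) := by
    funext m
    simp only [logMatrix, Matrix.of_apply, Complex.ofReal_mul]
  rw [hX]
  exact h

theorem integral_indicator_legendreQ (x : ℝ) (k : ℕ) :
    ∫ s in Set.Icc (-1 : ℝ) 1, (Set.Ioi x).indicator (fun s => (legendreQ k s : ℂ)) s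
      = (cutIntegral x k : ℂ) := by
  have hQ : ∀ a : ℝ, a ≤ 1 → ∫ s in Set.Ioc a 1, (legendreQ k s : ℂ)
      = ((legendreR k 1 - legendreR k a : ℝ) : ℂ) := by
    intro a ha
    rw [← intervalIntegral.integral_of_le ha, intervalIntegral.integral_ofReal, integral_legendreQ]
  rw [setIntegral_indicator measurableSet_Ioi, cutIntegral]
  by_cases h1 : x < -1
  · have hs : Set.Icc (-1 : ℝ) 1 ∩ Set.Ioi x = Set.Icc (-1) 1 :=
      Set.inter_eq_left.2 fun s hs => h1.trans_le hs.1
    rw [hs, if_pos h1, integral_Icc_eq_integral_Ioc, hQ _ (by norm_num)]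
  · have hs : Set.Icc (-1 : ℝ) 1 ∩ Set.Ioi x = Set.Ioc x 1 := by
      ext s
      simp only [Set.mem_inter_iff, Set.mem_Icc, Set.mem_Ioi, Set.mem_Ioc]
      constructor
      · exact fun h => ⟨h.2, h.1.2⟩
      · exact fun h => ⟨⟨by linarith [h.1], h.2⟩, h.1⟩
    rw [hs, if_neg h1]
    by_cases h2 : x ≤ 1
    · rw [if_pos h2, hQ x h2]
    · rw [if_neg h2, Set.Ioc_eq_empty (by intro h; linarith)]
      simp

/-- Integration by parts in `t` on each vertical line, then integration in `s`; the jump is present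
exactly on the lines `s > x`, which the indicator records. -/
theorem integral_log_mul_legendreQ_mul_legendreP (z : ℂ) (k j : ℕ) :
    ∫ p in square, Complex.log (z - ((p.1 : ℂ) + Complex.I * (p.2 : ℂ)))
        * ((legendreQ k p.1 : ℂ) * (legendreP j p.2 : ℂ))
      = (legendreQ j 1 : ℂ) * (∫ s in Set.Icc (-1 : ℝ) 1,
            Complex.log (z - Complex.I - (s : ℂ)) * (legendreQ k s : ℂ))
        - (legendreQ j (-1) : ℂ) * (∫ s in Set.Icc (-1 : ℝ) 1,
            Complex.log (z + Complex.I - (s : ℂ)) * (legendreQ k s : ℂ))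
        + Complex.I * (∫ p in square, (z - ((p.1 : ℂ) + Complex.I * (p.2 : ℂ)))⁻¹
            * ((legendreQ k p.1 : ℂ) * (legendreQ j p.2 : ℂ)))
        + cutCoeff j z.im * (cutIntegral z.re k : ℂ) := by
  have hf := integrableOn_mul_of_continuous (integrableOn_log z) (continuous_ofReal_legendreQ k)
    (continuous_ofReal_legendreP j)
  have hg := integrableOn_mul_of_continuous (integrableOn_inv z) (continuous_ofReal_legendreQ k)
    (continuous_ofReal_legendreQ j)
  rw [setIntegral_square hf, setIntegral_square hg, ← integral_indicator_legendreQ]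
  have i1 : ∀ c : ℂ, IntegrableOn (fun s : ℝ => Complex.log (c - (s : ℂ)) * (legendreQ k s : ℂ))
      (Set.Icc (-1) 1) := fun c => (integrableOn_log_sub_ofReal c).mul_continuousOn
    (continuous_ofReal_legendreQ k).continuousOn isCompact_Icc
  have i2 : Integrable (fun s : ℝ => ∫ t in Set.Icc (-1 : ℝ) 1,
      (z - ((s : ℂ) + Complex.I * (t : ℂ)))⁻¹ * ((legendreQ k s : ℂ) * (legendreQ j t : ℂ)))
      (volume.restrict (Set.Icc (-1) 1)) := by
    rw [IntegrableOn, restrict_square] at hg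
    exact hg.integral_prod_left
  have i3 : Integrable (fun s => (Set.Ioi z.re).indicator (fun s => (legendreQ k s : ℂ)) s)
      (volume.restrict (Set.Icc (-1) 1)) :=
    ((continuous_ofReal_legendreQ k).continuousOn.integrableOn_compact isCompact_Icc).indicator
      measurableSet_Ioi
  have i4 := ((i1 (z - Complex.I)).const_mul (legendreQ j 1 : ℂ)).sub
    ((i1 (z + Complex.I)).const_mul (legendreQ j (-1) : ℂ))
  have i5 := i4.add (i2.const_mul Complex.I)
  rw [← integral_const_mul, ← integral_const_mul, ← integral_const_mul, ← integral_const_mul,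
    ← integral_sub ((i1 _).const_mul _) ((i1 _).const_mul _)]
  refine Eq.trans ?_ ((integral_add i5 (i3.const_mul (cutCoeff j z.im))).trans
    (congrArg (· + _) (integral_add i4 (i2.const_mul Complex.I))))
  refine integral_congr_ae ?_
  -- The line through `z` is discarded as a null set.
  filter_upwards [ae_restrict_of_ae (ae_ne z.re)] with s hs
  have hpull : ∀ h q : ℝ → ℂ, ∫ t in Set.Icc (-1 : ℝ) 1, h t * ((legendreQ k s : ℂ) * q t)
      = (legendreQ k s : ℂ) * ∫ t in (-1 : ℝ)..1, h t * q t := by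
    intro h q
    rw [← setIntegral_Icc_eq, ← integral_const_mul]
    congr 1
    funext t
    ring
  simp only [hpull, Pi.add_apply, Pi.sub_apply]
  rcases lt_or_gt_of_ne hs with h | h
  · rw [integral_log_vertical_of_lt z h, Set.indicator_of_notMem (by simpa using h.le)]
    ring
  · rw [integral_log_vertical_of_gt z h, Set.indicator_of_mem (by simpa using h), cutCoeff]
    split_ifs <;> ring

/-- Here the inner variable is `s`; almost every horizontal line misses the cut, so no jump appears.
-/
theorem integral_log_mul_legendreP_mul_legendreQ (z : ℂ) (k j : ℕ) :
    ∫ p in square, Complex.log (z - ((p.1 : ℂ) + Complex.I * (p.2 : ℂ)))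
        * ((legendreP k p.1 : ℂ) * (legendreQ j p.2 : ℂ))
      = (legendreQ k 1 : ℂ) * (∫ t in Set.Icc (-1 : ℝ) 1,
            Complex.log (z - 1 - Complex.I * (t : ℂ)) * (legendreQ j t : ℂ))
        - (legendreQ k (-1) : ℂ) * (∫ t in Set.Icc (-1 : ℝ) 1,
            Complex.log (z + 1 - Complex.I * (t : ℂ)) * (legendreQ j t : ℂ))
        + ∫ p in square, (z - ((p.1 : ℂ) + Complex.I * (p.2 : ℂ)))⁻¹
            * ((legendreQ k p.1 : ℂ) * (legendreQ j p.2 : ℂ)) := by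
  have hf := integrableOn_mul_of_continuous (integrableOn_log z) (continuous_ofReal_legendreP k)
    (continuous_ofReal_legendreQ j)
  have hg := integrableOn_mul_of_continuous (integrableOn_inv z) (continuous_ofReal_legendreQ k)
    (continuous_ofReal_legendreQ j)
  rw [setIntegral_square_symm hf, setIntegral_square_symm hg]
  have i1 : ∀ c : ℂ, IntegrableOn
      (fun t : ℝ => Complex.log (c - Complex.I * (t : ℂ)) * (legendreQ j t : ℂ))
      (Set.Icc (-1) 1) := fun c => (integrableOn_log_sub_I_mul_ofReal c).mul_continuousOn
    (continuous_ofReal_legendreQ j).continuousOn isCompact_Icc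
  have i2 : Integrable (fun t : ℝ => ∫ s in Set.Icc (-1 : ℝ) 1,
      (z - ((s : ℂ) + Complex.I * (t : ℂ)))⁻¹ * ((legendreQ k s : ℂ) * (legendreQ j t : ℂ)))
      (volume.restrict (Set.Icc (-1) 1)) := by
    rw [IntegrableOn, restrict_square] at hg
    exact hg.integral_prod_right
  have i4 := ((i1 (z - 1)).const_mul (legendreQ k 1 : ℂ)).sub
    ((i1 (z + 1)).const_mul (legendreQ k (-1) : ℂ))
  rw [← integral_const_mul, ← integral_const_mul,
    ← integral_sub ((i1 _).const_mul _) ((i1 _).const_mul _)]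
  refine Eq.trans ?_ (integral_add i4 i2)
  refine integral_congr_ae ?_
  filter_upwards [ae_restrict_of_ae (ae_ne z.im)] with t ht
  have hpull : ∀ h q : ℝ → ℂ, ∫ s in Set.Icc (-1 : ℝ) 1, h s * (q s * (legendreQ j t : ℂ))
      = (legendreQ j t : ℂ) * ∫ s in (-1 : ℝ)..1, h s * q s := by
    intro h q
    rw [← setIntegral_Icc_eq, ← integral_const_mul]
    congr 1
    funext s
    ring
  simp only [hpull]
  rw [integral_log_horizontal z ht]
  ring

/-- The area terms cancel, and the values of `Q` at `±1` turn the edge terms into those of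
`FMatrix_apply`. -/
theorem logEntryRec_logMatrix (z : ℂ) (k j : ℕ) :
    LogEntryRec (FMatrix z) (logMatrix z) k j := by
  rw [LogEntryRec, logMatrix_sub_div_fst, logMatrix_sub_div_snd,
    integral_log_mul_legendreQ_mul_legendreP, integral_log_mul_legendreP_mul_legendreQ,
    FMatrix_apply, logInt_sub_div, logInt_sub_div, logIntI_sub_div, logIntI_sub_div,
    legendreQ_one, legendreQ_one, legendreQ_neg_one, legendreQ_neg_one]
  split_ifs <;> push_cast <;> ring

/-! ### Stieltjes integrals -/

theorem ofReal_mul_legendreP_succ (k : ℕ) (x : ℝ) :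
    (x : ℂ) * (legendreP (k + 1) x : ℂ)
      = ((((k + 1 : ℕ) : ℂ) + 1) * (legendreP (k + 2) x : ℂ)
        + ((k + 1 : ℕ) : ℂ) * (legendreP k x : ℂ)) / (2 * ((k + 1 : ℕ) : ℂ) + 1) := by
  rw [eq_div_iff (two_mul_natCast_add_one_ne_zero _)]
  have h : ((k : ℂ) + 2) * legendreP (k + 2) x
      = (2 * (k : ℂ) + 3) * x * legendreP (k + 1) x - ((k : ℂ) + 1) * legendreP k x := by
    exact_mod_cast legendreP_add_two k x
  push_cast
  linear_combination -h

theorem integral_mul_self_mul_legendreP {α : Type*} [MeasurableSpace α] {μ : Measure α}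
    {g : α → ℂ} {f : α → ℝ} (hi : ∀ k, Integrable (fun a => g a * (legendreP k (f a) : ℂ)) μ)
    (k : ℕ) :
    (((k : ℂ) + 1) * (∫ a, g a * (legendreP (k + 1) (f a) : ℂ) ∂μ)
        + (k : ℂ) * prevTerm (fun m => ∫ a, g a * (legendreP m (f a) : ℂ) ∂μ) k)
        / (2 * (k : ℂ) + 1)
      = ∫ a, g a * ((f a : ℂ) * (legendreP k (f a) : ℂ)) ∂μ := by
  cases k with
  | zero => simp [prevTerm, legendreP]
  | succ n =>
    simp only [prevTerm, ofReal_mul_legendreP_succ]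
    rw [← integral_const_mul, ← integral_const_mul,
      ← integral_add ((hi _).const_mul _) ((hi _).const_mul _), ← integral_div]
    congr 1
    funext a
    ring

theorem stieltjesMatrix_apply (z : ℂ) (k j : ℕ) :
    stieltjesMatrix z k j = ∫ p in square, (z - ((p.1 : ℂ) + Complex.I * (p.2 : ℂ)))⁻¹
      * ((legendreP k p.1 : ℂ) * (legendreP j p.2 : ℂ)) := by
  simp only [stieltjesMatrix, Matrix.of_apply, Complex.ofReal_mul, div_eq_mul_inv]
  congr 1
  funext p
  ring

theorem stieltjesMatrix_fst (z : ℂ) (k j : ℕ) :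
    (((k : ℂ) + 1) * stieltjesMatrix z (k + 1) j
        + (k : ℂ) * prevTerm (fun m => stieltjesMatrix z m j) k) / (2 * (k : ℂ) + 1)
      = ∫ p in square, (z - ((p.1 : ℂ) + Complex.I * (p.2 : ℂ)))⁻¹
          * (((p.1 : ℂ) * (legendreP k p.1 : ℂ)) * (legendreP j p.2 : ℂ)) := by
  have h := integral_mul_self_mul_legendreP (μ := volume.restrict square) (f := Prod.fst)
    (g := fun p => (z - ((p.1 : ℂ) + Complex.I * (p.2 : ℂ)))⁻¹ * (legendreP j p.2 : ℂ))
    (fun k => (integrableOn_mul_of_continuous (integrableOn_inv z) (continuous_ofReal_legendreP k)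
      (continuous_ofReal_legendreP j)).congr (Filter.Eventually.of_forall fun p => by
        dsimp only; ring)) k
  simp only [mul_assoc, mul_comm (legendreP j _ : ℂ)] at h
  simpa only [stieltjesMatrix_apply, mul_assoc] using h

theorem stieltjesMatrix_snd (z : ℂ) (k j : ℕ) :
    (((j : ℂ) + 1) * stieltjesMatrix z k (j + 1)
        + (j : ℂ) * prevTerm (stieltjesMatrix z k) j) / (2 * (j : ℂ) + 1)
      = ∫ p in square, (z - ((p.1 : ℂ) + Complex.I * (p.2 : ℂ)))⁻¹
          * ((legendreP k p.1 : ℂ) * ((p.2 : ℂ) * (legendreP j p.2 : ℂ))) := by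
  have h := integral_mul_self_mul_legendreP (μ := volume.restrict square) (f := Prod.snd)
    (g := fun p => (z - ((p.1 : ℂ) + Complex.I * (p.2 : ℂ)))⁻¹ * (legendreP k p.1 : ℂ))
    (fun j => (integrableOn_mul_of_continuous (integrableOn_inv z) (continuous_ofReal_legendreP k)
      (continuous_ofReal_legendreP j)).congr (Filter.Eventually.of_forall fun p => by
        dsimp only; ring)) j
  simp only [mul_assoc] at h
  have hX : stieltjesMatrix z k = fun m => _ := funext fun m => stieltjesMatrix_apply z k m
  rw [hX]
  exact h

/-- The recurrence multiplies the integrand by `s + it - z`, which cancels the kernel up to sign; a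
Legendre factor of positive index then integrates to zero. -/
theorem stieltjesEntryRec_stieltjesMatrix (z : ℂ) {k j : ℕ} (hkj : 0 < k ∨ 0 < j) :
    StieltjesEntryRec z (stieltjesMatrix z) k j := by
  have hP := continuous_ofReal_legendreP
  have hxP : ∀ n, Continuous fun x : ℝ => (x : ℂ) * (legendreP n x : ℂ) :=
    fun n => Complex.continuous_ofReal.mul (hP n)
  have hi := integrableOn_inv z
  have i1 := integrableOn_mul_of_continuous hi (hxP k) (hP j)
  have i2 := integrableOn_mul_of_continuous hi (hP k) (hxP j)
  have i3 := integrableOn_mul_of_continuous hi (hP k) (hP j)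
  rw [StieltjesEntryRec, stieltjesMatrix_fst, stieltjesMatrix_snd, stieltjesMatrix_apply,
    ← integral_const_mul, ← integral_const_mul, ← integral_add i1 (i2.const_mul _)]
  refine (integral_sub (i1.add (i2.const_mul Complex.I)) (i3.const_mul z)).symm.trans ?_
  have hP0 : ∀ n, 0 < n → ∫ x in Set.Icc (-1 : ℝ) 1, (legendreP n x : ℂ) = 0 := by
    intro n hn
    rw [setIntegral_Icc_eq, intervalIntegral.integral_ofReal, integral_legendreP n hn.ne',
      Complex.ofReal_zero]
  have hprod : ∫ p in square, -((legendreP k p.1 : ℂ) * (legendreP j p.2 : ℂ)) = 0 := by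
    rw [integral_neg, square, Measure.volume_eq_prod,
      setIntegral_prod_mul (fun s : ℝ => (legendreP k s : ℂ)) (fun t : ℝ => (legendreP j t : ℂ)),
      neg_eq_zero, mul_eq_zero]
    exact hkj.imp (hP0 k) (hP0 j)
  rw [← hprod]
  refine integral_congr_ae ?_
  filter_upwards [ae_fst_ne z.re] with p hp
  have hw : z - ((p.1 : ℂ) + Complex.I * (p.2 : ℂ)) ≠ 0 := by
    intro h
    apply hp
    have h2 := congrArg Complex.re h
    simp at h2
    linarith
  simp only [Pi.add_apply]
  linear_combination (-(legendreP k p.1 : ℂ) * (legendreP j p.2 : ℂ)) * inv_mul_cancel₀ hw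

end SquareIntegrals

end

theorem mainTheorem11 (z : ℂ) :
    -- columns and rows of `L(z)`
    (∀ j : ℕ, SquareIntegrals.LogColumnRec
      (SquareIntegrals.FMatrix z) (SquareIntegrals.logMatrix z) j) ∧
    (∀ k : ℕ, SquareIntegrals.LogRowRec
      (SquareIntegrals.FMatrix z) (SquareIntegrals.logMatrix z) k) ∧
    -- columns and rows of `S(z)`
    (∀ j : ℕ, 0 < j → SquareIntegrals.StieltjesColumnRec z (SquareIntegrals.stieltjesMatrix z) j) ∧
    (∀ k : ℕ, 0 < k → SquareIntegrals.StieltjesRowRec z (SquareIntegrals.stieltjesMatrix z) k) ∧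
    -- the recurrences determine all entries from the first row and column
    (∀ X : Matrix ℕ ℕ ℂ,
      (∀ j : ℕ, SquareIntegrals.LogColumnRec (SquareIntegrals.FMatrix z) X j) →
      (∀ k : ℕ, SquareIntegrals.LogRowRec (SquareIntegrals.FMatrix z) X k) →
      (∀ k : ℕ, X k 0 = SquareIntegrals.logMatrix z k 0) →
      (∀ j : ℕ, X 0 j = SquareIntegrals.logMatrix z 0 j) →
      X = SquareIntegrals.logMatrix z) ∧
    (∀ X : Matrix ℕ ℕ ℂ,
      (∀ j : ℕ, 0 < j → SquareIntegrals.StieltjesColumnRec z X j) →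
      (∀ k : ℕ, 0 < k → SquareIntegrals.StieltjesRowRec z X k) →
      (∀ k : ℕ, X k 0 = SquareIntegrals.stieltjesMatrix z k 0) →
      (∀ j : ℕ, X 0 j = SquareIntegrals.stieltjesMatrix z 0 j) →
      X = SquareIntegrals.stieltjesMatrix z) ∧
    -- forward substitution computes all entries up to total degree `p`
    (∀ p : ℕ,
      SquareIntegrals.logAlgorithm p (SquareIntegrals.truncDegree p (SquareIntegrals.FMatrix z))
          (SquareIntegrals.firstRowColumn p (SquareIntegrals.logMatrix z))
        = SquareIntegrals.truncDegree p (SquareIntegrals.logMatrix z)) ∧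
    (∀ p : ℕ,
      SquareIntegrals.stieltjesAlgorithm p z
          (SquareIntegrals.firstRowColumn p (SquareIntegrals.stieltjesMatrix z))
        = SquareIntegrals.truncDegree p (SquareIntegrals.stieltjesMatrix z)) := by
  have hL := SquareIntegrals.logEntryRec_logMatrix z
  have hS := fun k j => SquareIntegrals.stieltjesEntryRec_stieltjesMatrix z (k := k) (j := j)
  refine ⟨fun j => (SquareIntegrals.logColumnRec_iff _ _ j).2 fun k => hL k j,
    fun k => (SquareIntegrals.logRowRec_iff _ _ k).2 (hL k),
    fun j hj => (SquareIntegrals.stieltjesColumnRec_iff z _ j).2 fun k => hS k j (Or.inr hj),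
    fun k hk => (SquareIntegrals.stieltjesRowRec_iff z _ k).2 fun j => hS k j (Or.inl hk),
    ?_, ?_, SquareIntegrals.logAlgorithm_eq hL, SquareIntegrals.stieltjesAlgorithm_eq hS⟩
  · intro X hcol _ h0 _
    exact SquareIntegrals.LogEntryRec.unique
      (fun k j => (SquareIntegrals.logColumnRec_iff _ _ j).1 (hcol j) k) hL h0
  · intro X hcol _ h0 h1
    exact SquareIntegrals.StieltjesEntryRec.unique
      (fun k j hj => (SquareIntegrals.stieltjesColumnRec_iff z _ j).1 (hcol j hj) k)
      (fun k j hj => hS k j (Or.inr hj)) h0 h1
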